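/- Throughout, $\|\cdot\|$ is the $\infty$-norm of vectors and the induced matrix norm, $\|\cdot\|_2$ the Euclidean (operator) norm, $A^\dagger=(A^\top A)^{-1}A^\top$ for a matrix $A$ of full column rank, and $\lambda_{\min},\lambda_{\max}$ are extreme eigenvalues of symmetric matrices. **Plant.** $\dot x=A_mx+B_m(\omega u+f(x,t))$, $y=C_mx$, $x(0)=x_0$, with $x\in\mathbb R^n$, $u\in\mathbb R^m$, $y\in\mathbb R^p$, unknown constant $\omega\in[\omega_l,\omega_u]$, where $0<\omega_l<\omega_u$ and $1\in[\omega_l,\omega_u]$, and unknown $f$ such that for all $t\ge0$: $\|f(0,t)\|<b_0$, and, for every $\delta>0$, $f$ has partial derivatives with $\|\partial f/\partial x\|\le d_\delta$, $\|\partial f/\partial t\|\le b_\delta$ whenever $\|x\|<\delta$ (with known constants $b_0,d_\delta,b_\delta>0$). **Interactor.** $Z(s)=C_z(sI-A_z)^{-1}B_z+D_z$ with $A_z\in\mathbb R^{n_z\times n_z}$ Hurwitz and $\begin{bmatrix}A_z-sI&B_z\\C_z&D_z\end{bmatrix}$ nonsingular for all $s\in\mathbb C$; $T_z\in\mathbb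 R^{n\times n_z}$ has full column rank, $\bar B\in\mathbb R^{n\times m}$, $C_m\bar B$ has full column rank, and $A_mT_z=T_zA_z+\bar BC_z$, $C_mA_mT_z=C_m\bar BC_z$, $B_m=T_zB_z+\bar BD_z$, $C_mB_m=C_m\bar BD_z$. **Design.** $H=\bar B(C_m\bar B)^\dagger$, $A_v=(I-HC_m)A_m+K_vC_m$, $P_y,P_v,Q$ symmetric positive definite with $A_v^\top P_v+P_vA_v=-Q$, $0<\epsilon_q<\lambda_{\min}(Q)$, $Q_v=Q-\epsilon_qI$, $\bar P_v=(I-HC_m)^\top P_v(I-HC_m)$, and $\sqrt{P_y}$ the upper triangular factor in $P_y=\sqrt{P_y}^\top\sqrt{P_y}$. Let $\rho_x,\rho_u>0$, $T_g(\omega)=[I_n,\ \omega T_z]$, $T(s)=T_z(sI-A_z)^{-1}B_z$, $$\bar d=\max_{\omega\in[\omega_l,\omega_u]}\big(\|C_zT_z^\dagger T_g(\omega)\|+\|D_z\|\|T_g(\omega)\|d_{\rho_x}\big),$$ $$\bar b=\|C_zT_z^\dagger\|\rho_x+\|D_z\|\|T\|_{\mathcal L_1}d_{\rho_x}^2\rho_x+\|D_z\|(\|T\|_{\mathcal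 L_1}d_{\rho_x}+1)b_0,$$ and let $\alpha$ be such that $\alpha_y=2\alpha-\frac{m\bar d^2}{\epsilon_q}\|\sqrt{P_y}C_m\bar B\|_2^2>0$. **Controller.** With $\dot x_u=A_zx_u+B_zu$, $x_u(0)=0$, $u_z=C_zx_u+D_zu$, $\hat x_v=\hat v+Hy$, $\hat x_g=(\hat x_v,x_u)$, $\tilde y=\hat y-y$, $e_y=\bar B^\top C_m^\top P_y\tilde y$ and $\hat\eta=\hat\omega u_z+\hat\theta\|\hat x_g\|+\hat\sigma$, the predictor is $$\dot{\hat v}=A_v\hat x_v-K_vy-P_v^{-1}A_m^\top C_m^\top P_y\tilde y,\quad \dot{\hat y}=-\alpha\tilde y+C_mA_m\hat x_v+C_m\bar B\hat\eta,\quad \hat v(0)=0,\ \hat y(0)=C_mx_0,$$ the adaptive laws are $$\dot{\hat\omega}=\Gamma_\omega\mathrm{Proj}(\hat\omega,-u_z^\top e_y),\quad\dot{\hat\theta}=\Gamma_\theta\mathrm{Proj}(\hat\theta,-\|\hat x_g\|e_y),\quad\dot{\hat\sigma}=\Gamma_\sigma\mathrm{Proj}(\hat\sigma,-e_y),$$ with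 $\hat\omega(0)=1$, $\hat\theta(0)=\hat\sigma(0)=0$ and gains $\Gamma_\omega,\Gamma_\theta,\Gamma_\sigma>0$, and the control law is $u(s)=-D(s)Z^{-1}(s)(\hat\eta(s)-Z(s)K_gr(s))$ with $D(s)Z^{-1}(s)$ rational and strictly proper and $r$ a bounded measurable reference. $\mathrm{Proj}$ is the smooth projection operator with tolerance $\varepsilon>0$ for, respectively, the interval $[\omega_l,\omega_u]$ and the Euclidean balls about $0$ of radii $\sqrt m\,\bar d$ and $\sqrt m\,\bar b$: for the ball with centre $c$ and radius $R$, with $g(\theta)=(\|\theta-c\|_2^2-R^2)/(\varepsilon R^2)$, $\mathrm{Proj}(\theta,z)=z-g(\theta)\frac{\langle\theta-c,z\rangle}{\|\theta-c\|_2^2}(\theta-c)$ if $g(\theta)\ge0$ and $\langle\theta-c,z\rangle>0$, and $\mathrm{Proj}(\theta,z)=z$ otherwise. **Virtual system.** $\dot x_f=A_zx_f+B_zf(T_gx_g+T_zx_f,t)$, $x_f(0)=0$, and $\dot x_v=A_mx_v+\bar B(\omega u_z+\bar f)$, $x_v(0)=x_0$, where $x_g=(x_v,x_u)$ and $\bar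 f=C_zx_f+D_zf(T_gx_g+T_zx_f,t)$. Say that $(\bar l_\theta,\bar l_\sigma)$ are *rate bounds* for a closed-loop solution on $[0,\tau]$ if the virtual system has a solution on $[0,\tau]$ with $\bar f=\theta(t)\|x_g(t)\|+\sigma(t)$, $\|\theta(t)\|\le\bar d$, $\|\sigma(t)\|\le\bar b$ for $t\in[0,\tau]$, and $\theta,\sigma$ Lipschitz on $[0,\tau]$ with constants $\bar l_\theta,\bar l_\sigma$ (that is, $\|\dot\theta\|\le\bar l_\theta$, $\|\dot\sigma\|\le\bar l_\sigma$ almost everywhere). **Lemma 5.** Consider closed-loop solutions on $[0,\tau]$, $\tau>0$, with $\|x(t)\|\le\rho_x$ and $\|u(t)\|\le\rho_u$ for all $t\in[0,\tau]$. (i) There are $\bar l_\theta,\bar l_\sigma\ge0$, depending only on the plant, interactor and design data (not on $\omega$, $f$, $x_0$, $D$, $K_g$, $r$, the gains, $\varepsilon$ or $\tau$), which are rate bounds for every such solution. (ii) For all $\bar l_\theta,\bar l_\sigma\ge0$ there is $\varepsilon_0>0$, depending only on these two numbers and the same data, such that if $0<\varepsilon\le\varepsilon_0$, then for every such solution for which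 $(\bar l_\theta,\bar l_\sigma)$ are rate bounds, and all $t\in[0,\tau]$, $$\|\tilde y(t)\|\le\kappa_ye^{-\frac{\lambda_1}2t}\|x_0\|+\sqrt{\frac{\theta_1}{\lambda_{\min}(P_y)}}\,\frac1{\sqrt\Gamma},$$ where $\kappa_y=\sqrt{n\,\lambda_{\max}(\bar P_v)/\lambda_{\min}(P_y)}$, $\lambda_1=\min\big(\lambda_{\min}(Q_v)/\lambda_{\max}(P_v),\alpha_y\big)$, $\theta_1=4(\omega_u^2+m\bar d^2+m\bar b^2)+4m(\bar d\,\bar l_\theta+\bar b\,\bar l_\sigma)/\lambda_1$ and $\Gamma=\min(\Gamma_\omega,\Gamma_\theta,\Gamma_\sigma)$. -/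

import Mathlib

open Matrix Set

namespace L1Adaptive

noncomputable section

/-! ### Matrix and system-theoretic notions -/

/-- All (complex) eigenvalues of the real matrix `A` lie in the open left half-plane. -/
def IsHurwitz {k : ℕ} (A : Matrix (Fin k) (Fin k) ℝ) : Prop :=
  ∀ μ ∈ spectrum ℂ (A.map (algebraMap ℝ ℂ)), μ.re < 0

/-- The matrix norm induced by the vector `∞`-norm (maximal absolute row sum). -/
def infNorm {ι κ : Type} [Fintype ι] [Fintype κ] (A : Matrix ι κ ℝ) : ℝ :=
  letI : NormedAddCommGroup (Matrix ι κ ℝ) := Matrix.linftyOpNormedAddCommGroup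
  ‖A‖

/-- The matrix norm induced by the Euclidean vector norms (largest singular value). -/
def twoNorm {k l : ℕ} (A : Matrix (Fin k) (Fin l) ℝ) : ℝ :=
  letI : NormedAddCommGroup (Matrix (Fin k) (Fin l) ℝ) := Matrix.instL2OpNormedAddCommGroup
  ‖A‖

/-- The generalized (Moore-Penrose) left inverse `(AᵀA)⁻¹Aᵀ` of a matrix of full column rank. -/
def leftInv {k l : ℕ} (A : Matrix (Fin k) (Fin l) ℝ) : Matrix (Fin l) (Fin k) ℝ :=
  (Aᵀ * A)⁻¹ * Aᵀ

/-- Smallest eigenvalue of a real symmetric matrix. -/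
def lambdaMin {k : ℕ} (A : Matrix (Fin k) (Fin k) ℝ) : ℝ := sInf (spectrum ℝ A)

/-- Largest eigenvalue of a real symmetric matrix. -/
def lambdaMax {k : ℕ} (A : Matrix (Fin k) (Fin k) ℝ) : ℝ := sSup (spectrum ℝ A)

/-- The transfer matrix `C (s I - A)⁻¹ B + D`, with entries in the field `ℝ(s)`. -/
def transfer {k l q : ℕ} (A : Matrix (Fin k) (Fin k) ℝ) (B : Matrix (Fin k) (Fin l) ℝ)
    (C : Matrix (Fin q) (Fin k) ℝ) (D : Matrix (Fin q) (Fin l) ℝ) :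
    Matrix (Fin q) (Fin l) (RatFunc ℝ) :=
  C.map RatFunc.C *
      ((RatFunc.X : RatFunc ℝ) • (1 : Matrix (Fin k) (Fin k) (RatFunc ℝ)) - A.map RatFunc.C)⁻¹ *
    B.map RatFunc.C + D.map RatFunc.C

/-- The `𝓛₁` norm `max_i ∑_j ∫_0^∞ |h_{ij}(t)| dt` of the strictly proper transfer matrix
`C (s I - A)⁻¹ B`, whose impulse response is `h(t) = C e^{At} B`. -/
def l1Norm {k l q : ℕ} (A : Matrix (Fin k) (Fin k) ℝ) (B : Matrix (Fin k) (Fin l) ℝ)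
    (C : Matrix (Fin q) (Fin k) ℝ) : ℝ :=
  ⨆ i : Fin q, ∑ j : Fin l, ∫ t in Ioi (0 : ℝ), |(C * NormedSpace.exp (t • A) * B) i j|

/-- The smooth (Pomet-Praly) projection operator for the ball with centre `c` and radius `R`, with
boundary layer of relative width `ε`. With `g(θ) = (‖θ - c‖² - R²) / (ε R²)`,
`Proj(θ, y) = y - g(θ) ⟨∇g, y⟩ ∇g / ‖∇g‖²` if `g(θ) ≥ 0` and `⟨∇g, y⟩ > 0`, and
`Proj(θ, y) = y` otherwise (`∇g` is a positive multiple of `θ - c`). -/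
def smoothProj {E : Type} [NormedAddCommGroup E] [InnerProductSpace ℝ E]
    (ε : ℝ) (c : E) (R : ℝ) (θ y : E) : E :=
  open Classical in
  if 0 ≤ (‖θ - c‖ ^ 2 - R ^ 2) / (ε * R ^ 2) ∧ 0 < inner ℝ (θ - c) y then
    y - ((‖θ - c‖ ^ 2 - R ^ 2) / (ε * R ^ 2) * inner ℝ (θ - c) y / ‖θ - c‖ ^ 2) • (θ - c)
  else y

/-- The smooth projection operator on `ℝᵏ` for the Euclidean ball of radius `R` about `0`. -/
def vecProj {k : ℕ} (ε R : ℝ) (θ y : Fin k → ℝ) : Fin k → ℝ :=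
  (smoothProj ε (0 : EuclideanSpace ℝ (Fin k)) R (WithLp.toLp 2 θ) (WithLp.toLp 2 y)).ofLp

/-! ### Design data -/

/-- The known data: the desired dynamics, the interactor, the predictor design and the a priori
bounds on the uncertainties. -/
structure Design (n m p nz : ℕ) where
  Am : Matrix (Fin n) (Fin n) ℝ
  Bm : Matrix (Fin n) (Fin m) ℝ
  Cm : Matrix (Fin p) (Fin n) ℝ
  Az : Matrix (Fin nz) (Fin nz) ℝ
  Bz : Matrix (Fin nz) (Fin m) ℝ
  Cz : Matrix (Fin m) (Fin nz) ℝ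
  Dz : Matrix (Fin m) (Fin m) ℝ
  Tz : Matrix (Fin n) (Fin nz) ℝ
  Bbar : Matrix (Fin n) (Fin m) ℝ
  Kv : Matrix (Fin n) (Fin p) ℝ
  Py : Matrix (Fin p) (Fin p) ℝ
  /-- Cholesky factor of `Py`. -/
  sqrtPy : Matrix (Fin p) (Fin p) ℝ
  Pv : Matrix (Fin n) (Fin n) ℝ
  Q : Matrix (Fin n) (Fin n) ℝ
  εq : ℝ
  α : ℝ
  ωl : ℝ
  ωu : ℝ
  /-- Bound on `‖f(0, t)‖`. -/
  b₀ : ℝ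
  /-- `d δ` bounds `‖∂f/∂x‖` on `‖x‖ < δ`. -/
  d : ℝ → ℝ
  /-- `b δ` bounds `‖∂f/∂t‖` on `‖x‖ < δ`. -/
  b : ℝ → ℝ
  ρx : ℝ
  ρu : ℝ

namespace Design

variable {n m p nz : ℕ} (S : Design n m p nz)

def H : Matrix (Fin n) (Fin p) ℝ := S.Bbar * leftInv (S.Cm * S.Bbar)

def AH : Matrix (Fin n) (Fin n) ℝ := (1 - S.H * S.Cm) * S.Am

def Av : Matrix (Fin n) (Fin n) ℝ := S.AH + S.Kv * S.Cm

def PvBar : Matrix (Fin n) (Fin n) ℝ := (1 - S.H * S.Cm)ᵀ * S.Pv * (1 - S.H * S.Cm)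

def Qv : Matrix (Fin n) (Fin n) ℝ := S.Q - S.εq • 1

/-- `T_g = [I, ω T_z]`. -/
def Tg (ω : ℝ) : Matrix (Fin n) (Fin n ⊕ Fin nz) ℝ := Matrix.fromCols 1 (ω • S.Tz)

/-- The bound on `θ`. -/
def dBar : ℝ :=
  sSup ((fun ω : ℝ => infNorm (S.Cz * leftInv S.Tz * S.Tg ω) +
    infNorm S.Dz * infNorm (S.Tg ω) * S.d S.ρx) '' Icc S.ωl S.ωu)

/-- The bound on `σ`. -/
def bBar : ℝ :=
  infNorm (S.Cz * leftInv S.Tz) * S.ρx +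
    infNorm S.Dz * l1Norm S.Az S.Bz S.Tz * S.d S.ρx ^ 2 * S.ρx +
    infNorm S.Dz * (l1Norm S.Az S.Bz S.Tz * S.d S.ρx + 1) * S.b₀

def αφ : ℝ := m * S.dBar ^ 2 / S.εq * twoNorm (S.sqrtPy * S.Cm * S.Bbar) ^ 2

def αy : ℝ := 2 * S.α - S.αφ

def κy : ℝ := √(n * (lambdaMax S.PvBar / lambdaMin S.Py))

def lam₁ : ℝ := min (lambdaMin S.Qv / lambdaMax S.Pv) S.αy

def θ₀ : ℝ := 4 * (S.ωu ^ 2 + m * S.dBar ^ 2 + m * S.bBar ^ 2)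

def θ₁ (lθ lσ : ℝ) : ℝ := S.θ₀ + 4 * m * ((S.dBar * lθ + S.bBar * lσ) / S.lam₁)

/-- The constraints on the design data. (That `Av` is Hurwitz follows from `lyapunov`.) -/
structure Admissible : Prop where
  Az_hurwitz : IsHurwitz S.Az
  pencil : ∀ s : ℂ, (Matrix.fromBlocks
    (S.Az.map (algebraMap ℝ ℂ) - s • (1 : Matrix (Fin nz) (Fin nz) ℂ))
    (S.Bz.map (algebraMap ℝ ℂ)) (S.Cz.map (algebraMap ℝ ℂ)) (S.Dz.map (algebraMap ℝ ℂ))).det ≠ 0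
  AmTz : S.Am * S.Tz = S.Tz * S.Az + S.Bbar * S.Cz
  CmAmTz : S.Cm * S.Am * S.Tz = S.Cm * S.Bbar * S.Cz
  Bm_eq : S.Bm = S.Tz * S.Bz + S.Bbar * S.Dz
  CmBm : S.Cm * S.Bm = S.Cm * S.Bbar * S.Dz
  rank_Tz : S.Tz.rank = nz
  rank_CmBbar : (S.Cm * S.Bbar).rank = m
  Py_pos : S.Py.PosDef
  Pv_pos : S.Pv.PosDef
  Q_pos : S.Q.PosDef
  lyapunov : S.Avᵀ * S.Pv + S.Pv * S.Av = -S.Q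
  εq_pos : 0 < S.εq
  εq_lt : S.εq < lambdaMin S.Q
  sqrtPy_upper : S.sqrtPy.BlockTriangular id
  sqrtPy_sq : S.sqrtPyᵀ * S.sqrtPy = S.Py
  αy_pos : 0 < S.αy
  ωl_pos : 0 < S.ωl
  ωl_lt : S.ωl < S.ωu
  /-- The initial value `1` of the estimate of the input gain is an admissible gain. -/
  one_mem : (1 : ℝ) ∈ Icc S.ωl S.ωu
  b₀_pos : 0 < S.b₀
  d_pos : ∀ δ > 0, 0 < S.d δ
  b_pos : ∀ δ > 0, 0 < S.b δ
  ρx_pos : 0 < S.ρx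
  ρu_pos : 0 < S.ρu

end Design

/-! ### Unknowns, controller, signals -/

/-- The unknown input gain, matched uncertainty and initial state. -/
structure Unknowns (n m : ℕ) where
  ω : ℝ
  f : (Fin n → ℝ) → ℝ → (Fin m → ℝ)
  x₀ : Fin n → ℝ

/-- The assumptions on the unknowns. The operator norm of the Fréchet derivative with respect to
the sup norms is the matrix `∞`-norm of the Jacobian. -/
structure Unknowns.Admissible {n m p nz : ℕ} (W : Unknowns n m) (S : Design n m p nz) : Prop where
  ω_mem : W.ω ∈ Icc S.ωl S.ωu
  f_zero : ∀ t ≥ 0, ‖W.f 0 t‖ < S.b₀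
  f_dx : ∀ δ > 0, ∀ x : Fin n → ℝ, ‖x‖ < δ → ∀ t ≥ 0,
    DifferentiableAt ℝ (fun z => W.f z t) x ∧ ‖fderiv ℝ (fun z => W.f z t) x‖ ≤ S.d δ
  f_dt : ∀ δ > 0, ∀ x : Fin n → ℝ, ‖x‖ < δ → ∀ t ≥ 0,
    DifferentiableWithinAt ℝ (W.f x) (Ici 0) t ∧ ‖derivWithin (W.f x) (Ici 0) t‖ ≤ S.b δ

/-- Controller data: the filter `D(s)`, a state-space realization `(Ad, Bd, Cd)` of
`D(s) Z⁻¹(s)`, the feed-forward gain and the reference, the adaptation gains, and the tolerance of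
the projection operators. -/
structure Controller (m mr nd : ℕ) where
  D : Matrix (Fin m) (Fin m) (RatFunc ℝ)
  Ad : Matrix (Fin nd) (Fin nd) ℝ
  Bd : Matrix (Fin nd) (Fin m) ℝ
  Cd : Matrix (Fin m) (Fin nd) ℝ
  Kg : Matrix (Fin m) (Fin mr) ℝ
  r : ℝ → Fin mr → ℝ
  Γω : ℝ
  Γθ : ℝ
  Γσ : ℝ
  ε : ℝ

/-- `Γ`, the smallest adaptation gain. -/
def Controller.Γ {m mr nd : ℕ} (K : Controller m mr nd) : ℝ := min K.Γω (min K.Γθ K.Γσ)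

structure Controller.Admissible {n m p nz mr nd : ℕ} (K : Controller m mr nd)
    (S : Design n m p nz) : Prop where
  realization : transfer K.Ad K.Bd K.Cd 0 = K.D * (transfer S.Az S.Bz S.Cz S.Dz)⁻¹
  r_meas : Measurable K.r
  r_bdd : ∃ R : ℝ, ∀ t ≥ 0, ‖K.r t‖ ≤ R
  Γω_pos : 0 < K.Γω
  Γθ_pos : 0 < K.Γθ
  Γσ_pos : 0 < K.Γσ
  ε_pos : 0 < K.ε

/-- The signals of the closed loop: plant state `x`, input `u`, input-filter state `xu`, predictor
states `vHat`, `yHat`, adaptive estimates, and the states `xd`, `xr` of the control filter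
`D(s) Z⁻¹(s)` and of the reference filter `Z(s)`. -/
structure Signals (n m p nz nd : ℕ) where
  x : ℝ → Fin n → ℝ
  u : ℝ → Fin m → ℝ
  xu : ℝ → Fin nz → ℝ
  vHat : ℝ → Fin n → ℝ
  yHat : ℝ → Fin p → ℝ
  ωHat : ℝ → ℝ
  θHat : ℝ → Fin m → ℝ
  σHat : ℝ → Fin m → ℝ
  xd : ℝ → Fin nd → ℝ
  xr : ℝ → Fin nz → ℝ

namespace Signals

variable {n m p nz mr nd : ℕ} (s : Signals n m p nz nd) (S : Design n m p nz)

/-- The measured output. -/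
def y (t : ℝ) : Fin p → ℝ := S.Cm *ᵥ s.x t

/-- The output-estimation error. -/
def yTilde (t : ℝ) : Fin p → ℝ := s.yHat t - s.y S t

def uz (t : ℝ) : Fin m → ℝ := S.Cz *ᵥ s.xu t + S.Dz *ᵥ s.u t

def xvHat (t : ℝ) : Fin n → ℝ := s.vHat t + S.H *ᵥ s.y S t

def xgHat (t : ℝ) : Fin n ⊕ Fin nz → ℝ := Sum.elim (s.xvHat S t) (s.xu t)

def ηHat (t : ℝ) : Fin m → ℝ :=
  s.ωHat t • s.uz S t + ‖s.xgHat S t‖ • s.θHat t + s.σHat t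

def ey (t : ℝ) : Fin m → ℝ := (S.Bbarᵀ * S.Cmᵀ * S.Py) *ᵥ s.yTilde S t

/-- The filtered reference `r_z(s) = Z(s) K_g r(s)`. -/
def rz (K : Controller m mr nd) (t : ℝ) : Fin m → ℝ := S.Cz *ᵥ s.xr t + S.Dz *ᵥ K.Kg *ᵥ K.r t

/-- The signals solve the closed-loop equations on `[0, τ]`. The two filters driven by the
reference, which need not be continuous, are solved in integrated form; all other equations
hold pointwise. -/
structure IsClosedLoop (W : Unknowns n m) (K : Controller m mr nd) (τ : ℝ) : Prop where
  x_zero : s.x 0 = W.x₀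
  x_ode : ∀ t ∈ Icc 0 τ, HasDerivWithinAt s.x
    (S.Am *ᵥ s.x t + S.Bm *ᵥ (W.ω • s.u t + W.f (s.x t) t)) (Icc 0 τ) t
  xu_zero : s.xu 0 = 0
  xu_ode : ∀ t ∈ Icc 0 τ, HasDerivWithinAt s.xu (S.Az *ᵥ s.xu t + S.Bz *ᵥ s.u t) (Icc 0 τ) t
  xr_cont : ContinuousOn s.xr (Icc 0 τ)
  xr_eq : ∀ t ∈ Icc 0 τ, s.xr t = ∫ q in (0 : ℝ)..t, (S.Az *ᵥ s.xr q + S.Bz *ᵥ K.Kg *ᵥ K.r q)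
  xd_cont : ContinuousOn s.xd (Icc 0 τ)
  xd_eq : ∀ t ∈ Icc 0 τ, s.xd t =
    ∫ q in (0 : ℝ)..t, (K.Ad *ᵥ s.xd q + K.Bd *ᵥ (s.ηHat S q - s.rz S K q))
  u_eq : ∀ t ∈ Icc 0 τ, s.u t = -(K.Cd *ᵥ s.xd t)
  vHat_zero : s.vHat 0 = 0
  vHat_ode : ∀ t ∈ Icc 0 τ, HasDerivWithinAt s.vHat
    (S.Av *ᵥ s.xvHat S t - S.Kv *ᵥ s.y S t - (S.Pv⁻¹ * S.Amᵀ * S.Cmᵀ * S.Py) *ᵥ s.yTilde S t)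
    (Icc 0 τ) t
  yHat_zero : s.yHat 0 = S.Cm *ᵥ W.x₀
  yHat_ode : ∀ t ∈ Icc 0 τ, HasDerivWithinAt s.yHat
    (-(S.α • s.yTilde S t) + (S.Cm * S.Am) *ᵥ s.xvHat S t + (S.Cm * S.Bbar) *ᵥ s.ηHat S t)
    (Icc 0 τ) t
  ωHat_zero : s.ωHat 0 = 1
  ωHat_ode : ∀ t ∈ Icc 0 τ, HasDerivWithinAt s.ωHat
    (K.Γω * smoothProj K.ε ((S.ωl + S.ωu) / 2) ((S.ωu - S.ωl) / 2) (s.ωHat t)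
      (-(s.uz S t ⬝ᵥ s.ey S t))) (Icc 0 τ) t
  θHat_zero : s.θHat 0 = 0
  θHat_ode : ∀ t ∈ Icc 0 τ, HasDerivWithinAt s.θHat
    (K.Γθ • vecProj K.ε (√m * S.dBar) (s.θHat t) (-(‖s.xgHat S t‖ • s.ey S t))) (Icc 0 τ) t
  σHat_zero : s.σHat 0 = 0
  σHat_ode : ∀ t ∈ Icc 0 τ, HasDerivWithinAt s.σHat
    (K.Γσ • vecProj K.ε (√m * S.bBar) (s.σHat t) (-(s.ey S t))) (Icc 0 τ) t

/-- State and input stay within `ρx` and `ρu` on `[0, τ]`. -/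
def Bounded (τ : ℝ) : Prop :=
  ∀ t ∈ Icc 0 τ, ‖s.x t‖ ≤ S.ρx ∧ ‖s.u t‖ ≤ S.ρu

/-- `x_g = (x_v, x_u)`. -/
def xg (xv : ℝ → Fin n → ℝ) (t : ℝ) : Fin n ⊕ Fin nz → ℝ := Sum.elim (xv t) (s.xu t)

/-- The matched uncertainty evaluated along the virtual system, `f(T_g x_g + T_z x_f, t)`. -/
def fv (W : Unknowns n m) (xv : ℝ → Fin n → ℝ) (xf : ℝ → Fin nz → ℝ) (t : ℝ) : Fin m → ℝ :=
  W.f (S.Tg W.ω *ᵥ s.xg xv t + S.Tz *ᵥ xf t) t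

/-- The lumped uncertainty `f̄(X, t)` of the virtual system. -/
def fBar (W : Unknowns n m) (xv : ℝ → Fin n → ℝ) (xf : ℝ → Fin nz → ℝ) (t : ℝ) : Fin m → ℝ :=
  S.Cz *ᵥ xf t + S.Dz *ᵥ s.fv S W xv xf t

/-- `(x_v, x_f)` solves the virtual system on `[0, τ]`. -/
structure IsVirtual (W : Unknowns n m) (τ : ℝ) (xv : ℝ → Fin n → ℝ) (xf : ℝ → Fin nz → ℝ) :
    Prop where
  xf_zero : xf 0 = 0
  xf_ode : ∀ t ∈ Icc 0 τ,
    HasDerivWithinAt xf (S.Az *ᵥ xf t + S.Bz *ᵥ s.fv S W xv xf t) (Icc 0 τ) t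
  xv_zero : xv 0 = W.x₀
  xv_ode : ∀ t ∈ Icc 0 τ, HasDerivWithinAt xv
    (S.Am *ᵥ xv t + S.Bbar *ᵥ (W.ω • s.uz S t + s.fBar S W xv xf t)) (Icc 0 τ) t

/-- The lumped uncertainty of the virtual system is `θ(t) ‖x_g(t)‖ + σ(t)` on `[0, τ]`, where
`θ` and `σ` are bounded by `dBar` and `bBar` and have rates of change bounded by `lθ` and `lσ`.
The rate bounds are Lipschitz bounds: for (piecewise) differentiable functions these are bounds
on the derivatives, and in general bounds on the derivatives almost everywhere. -/
def Parametrized (W : Unknowns n m) (τ lθ lσ : ℝ) : Prop :=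
  ∃ (xv : ℝ → Fin n → ℝ) (xf : ℝ → Fin nz → ℝ) (θ σ : ℝ → Fin m → ℝ),
    s.IsVirtual S W τ xv xf ∧
    (∀ t ∈ Icc 0 τ, s.fBar S W xv xf t = ‖s.xg xv t‖ • θ t + σ t) ∧
    (∀ t ∈ Icc 0 τ, ‖θ t‖ ≤ S.dBar ∧ ‖σ t‖ ≤ S.bBar) ∧
    (∀ t ∈ Icc 0 τ, ∀ t' ∈ Icc 0 τ,
      ‖θ t - θ t'‖ ≤ lθ * |t - t'| ∧ ‖σ t - σ t'‖ ≤ lσ * |t - t'|)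

end Signals

end

end L1Adaptive

/-!
The virtual system splits the plant state as `x = T_g x_g + T_z x_f`, so that the measured output
is `C_m x_v` and the whole uncertainty enters `x_v` through `B̄`, as the lumped uncertainty `f̄`.
The bounds on `f` and on the `𝓛₁` norm of the filter from `f` to `T_z x_f` give
`‖f̄‖ ≤ d̄ ‖x_g‖ + b̄`, and `f̄` is distributed over `θ ‖x_g‖ + σ` in the proportion
`d̄ ‖x_g‖ : b̄`; all signals involved have bounded rates because the plant state and the input are
bounded.

The error bound comes from the Lyapunov function
`⟨x̃_v, P_v x̃_v⟩ + ⟨ỹ, P_y ỹ⟩ + |ω̃|² / Γ_ω + ‖θ̃‖² / Γ_θ + ‖σ̃‖² / Γ_σ`.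
The adaptive laws cancel the parameter errors in its derivative up to the mismatch between `‖x̂_g‖`
and `‖x_g‖`, which Young's inequality absorbs into the margins `εq` and `αφ`. The projection keeps
the parameter errors bounded, so the function decays at rate `λ₁` down to a level of order `1 / Γ`,
which for small tolerances `ε` of the projection lies below `θ₁ / Γ`.
-/

namespace L1Adaptive

/-! ### Matrix norms, extreme eigenvalues and left inverses -/

section Norms

variable {ι κ : Type} [Fintype κ]

theorem abs_mulVec_apply_le (A : Matrix ι κ ℝ) {v : κ → ℝ} {c : ℝ} (hv : ‖v‖ ≤ c) (i : ι) :
    |(A *ᵥ v) i| ≤ (∑ j, |A i j|) * c := by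
  rw [Finset.sum_mul]
  refine (Finset.abs_sum_le_sum_abs _ _).trans (Finset.sum_le_sum fun j _ => ?_)
  rw [abs_mul]
  exact mul_le_mul_of_nonneg_left ((norm_le_pi_norm v j).trans hv) (abs_nonneg _)

variable [Fintype ι]

theorem infNorm_nonneg (A : Matrix ι κ ℝ) : 0 ≤ infNorm A :=
  letI : NormedAddCommGroup (Matrix ι κ ℝ) := Matrix.linftyOpNormedAddCommGroup
  norm_nonneg A

theorem infNorm_pos {A : Matrix ι κ ℝ} (hA : A ≠ 0) : 0 < infNorm A :=
  letI : NormedAddCommGroup (Matrix ι κ ℝ) := Matrix.linftyOpNormedAddCommGroup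
  norm_pos_iff.2 hA

theorem norm_mulVec_le_infNorm (A : Matrix ι κ ℝ) (v : κ → ℝ) : ‖A *ᵥ v‖ ≤ infNorm A * ‖v‖ :=
  Matrix.linfty_opNorm_mulVec A v

theorem norm_mulVec_le_of_norm_le (A : Matrix ι κ ℝ) {v : κ → ℝ} {c : ℝ} (hv : ‖v‖ ≤ c) :
    ‖A *ᵥ v‖ ≤ infNorm A * c :=
  (norm_mulVec_le_infNorm A v).trans (mul_le_mul_of_nonneg_left hv (infNorm_nonneg A))

theorem continuous_infNorm : Continuous (infNorm : Matrix ι κ ℝ → ℝ) :=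
  letI : NormedAddCommGroup (Matrix ι κ ℝ) := Matrix.linftyOpNormedAddCommGroup
  continuous_norm

end Norms

section DotProduct

variable {ι : Type*} [Fintype ι]

theorem dotProduct_self_nonneg (v : ι → ℝ) : 0 ≤ v ⬝ᵥ v := by
  simpa only [star_trivial] using dotProduct_self_star_nonneg v

theorem dotProduct_eq_inner_toLp (v w : ι → ℝ) :
    v ⬝ᵥ w = inner ℝ (WithLp.toLp 2 v : EuclideanSpace ℝ ι) (WithLp.toLp 2 w) := by
  rw [EuclideanSpace.inner_toLp_toLp, star_trivial, dotProduct_comm]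

theorem dotProduct_self_eq_norm_toLp_sq (v : ι → ℝ) :
    v ⬝ᵥ v = ‖(WithLp.toLp 2 v : EuclideanSpace ℝ ι)‖ ^ 2 := by
  rw [dotProduct_eq_inner_toLp, real_inner_self_eq_norm_sq]

theorem norm_sq_le_dotProduct_self (v : ι → ℝ) : ‖v‖ ^ 2 ≤ v ⬝ᵥ v := by
  rw [dotProduct_self_eq_norm_toLp_sq]
  gcongr
  exact (pi_norm_le_iff_of_nonneg (norm_nonneg _)).2
    (PiLp.norm_apply_le (WithLp.toLp 2 v : EuclideanSpace ℝ ι))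

theorem dotProduct_self_le_card_mul_norm_sq (v : ι → ℝ) :
    v ⬝ᵥ v ≤ Fintype.card ι * ‖v‖ ^ 2 := by
  calc v ⬝ᵥ v = ∑ i, ‖v i‖ ^ 2 := by simp [dotProduct, sq]
    _ ≤ ∑ _i : ι, ‖v‖ ^ 2 := by gcongr with i; exact norm_le_pi_norm v i
    _ = Fintype.card ι * ‖v‖ ^ 2 := by simp

theorem norm_toLp_le_sqrt_card_mul {v : ι → ℝ} {c : ℝ} (hv : ‖v‖ ≤ c) :
    ‖(WithLp.toLp 2 v : EuclideanSpace ℝ ι)‖ ≤ √(Fintype.card ι) * c := by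
  refine le_of_sq_le_sq ?_ (by positivity [(norm_nonneg v).trans hv])
  rw [← dotProduct_self_eq_norm_toLp_sq, mul_pow, Real.sq_sqrt (Nat.cast_nonneg _)]
  exact (dotProduct_self_le_card_mul_norm_sq v).trans (by gcongr)

theorem dotProduct_mulVec_self_le_twoNorm {k l : ℕ} (A : Matrix (Fin k) (Fin l) ℝ)
    (v : Fin l → ℝ) : (A *ᵥ v) ⬝ᵥ (A *ᵥ v) ≤ twoNorm A ^ 2 * (v ⬝ᵥ v) := by
  rw [dotProduct_self_eq_norm_toLp_sq, dotProduct_self_eq_norm_toLp_sq, ← mul_pow]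
  exact pow_le_pow_left₀ (norm_nonneg _)
    (Matrix.l2_opNorm_mulVec A (WithLp.toLp 2 v : EuclideanSpace ℝ (Fin l))) 2

end DotProduct

section Eigenvalues

open scoped MatrixOrder

variable {k : ℕ} {A : Matrix (Fin k) (Fin k) ℝ}

theorem lambdaMin_mem_spectrum (hk : 0 < k) (hA : A.IsHermitian) : lambdaMin A ∈ spectrum ℝ A := by
  have : Nonempty (Fin k) := ⟨⟨0, hk⟩⟩
  refine Set.Nonempty.csInf_mem ?_ (A.finite_spectrum)
  rw [hA.spectrum_real_eq_range_eigenvalues]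
  exact range_nonempty _

theorem lambdaMax_mem_spectrum (hk : 0 < k) (hA : A.IsHermitian) : lambdaMax A ∈ spectrum ℝ A := by
  have : Nonempty (Fin k) := ⟨⟨0, hk⟩⟩
  refine Set.Nonempty.csSup_mem ?_ (A.finite_spectrum)
  rw [hA.spectrum_real_eq_range_eigenvalues]
  exact range_nonempty _

theorem lambdaMin_mul_dotProduct_le (hA : A.IsHermitian) (v : Fin k → ℝ) :
    lambdaMin A * (v ⬝ᵥ v) ≤ v ⬝ᵥ (A *ᵥ v) := by
  have h : algebraMap ℝ (Matrix (Fin k) (Fin k) ℝ) (lambdaMin A) ≤ A :=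
    algebraMap_le_of_le_spectrum
      (fun _ hx => csInf_le (A.finite_spectrum).bddBelow hx) hA
  have h0 := (Matrix.le_iff.1 h).dotProduct_mulVec_nonneg v
  rw [star_trivial, sub_mulVec, dotProduct_sub, Algebra.algebraMap_eq_smul_one, smul_mulVec,
    one_mulVec, dotProduct_smul, smul_eq_mul] at h0
  linarith

theorem dotProduct_le_lambdaMax_mul (hA : A.IsHermitian) (v : Fin k → ℝ) :
    v ⬝ᵥ (A *ᵥ v) ≤ lambdaMax A * (v ⬝ᵥ v) := by
  have h : A ≤ algebraMap ℝ (Matrix (Fin k) (Fin k) ℝ) (lambdaMax A) :=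
    le_algebraMap_of_spectrum_le
      (fun _ hx => le_csSup (A.finite_spectrum).bddAbove hx) hA
  have h0 := (Matrix.le_iff.1 h).dotProduct_mulVec_nonneg v
  rw [star_trivial, sub_mulVec, dotProduct_sub, Algebra.algebraMap_eq_smul_one, smul_mulVec,
    one_mulVec, dotProduct_smul, smul_eq_mul] at h0
  linarith

theorem spectrum_pos_of_posDef (hA : A.PosDef) {a : ℝ} (ha : a ∈ spectrum ℝ A) : 0 < a := by
  rw [hA.isHermitian.spectrum_real_eq_range_eigenvalues] at ha
  obtain ⟨i, rfl⟩ := ha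
  exact hA.eigenvalues_pos i

theorem lambdaMin_pos (hk : 0 < k) (hA : A.PosDef) : 0 < lambdaMin A :=
  spectrum_pos_of_posDef hA (lambdaMin_mem_spectrum hk hA.isHermitian)

theorem lambdaMax_pos (hk : 0 < k) (hA : A.PosDef) : 0 < lambdaMax A :=
  spectrum_pos_of_posDef hA (lambdaMax_mem_spectrum hk hA.isHermitian)

theorem lambdaMax_nonneg (hA : A.PosSemidef) : 0 ≤ lambdaMax A :=
  Real.sSup_nonneg fun _ ha => (posSemidef_iff_isHermitian_and_spectrum_nonneg.1 hA).2 ha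

theorem lambdaMin_sub_smul_one_pos (hk : 0 < k) (hA : A.IsHermitian) {c : ℝ}
    (hc : c < lambdaMin A) : 0 < lambdaMin (A - c • 1) := by
  have hB : (A - c • (1 : Matrix (Fin k) (Fin k) ℝ)).IsHermitian :=
    hA.sub (isHermitian_one.smul (IsSelfAdjoint.all c))
  have hm := lambdaMin_mem_spectrum hk hB
  rw [← Algebra.algebraMap_eq_smul_one, ← spectrum.sub_singleton_eq] at hm
  obtain ⟨a, ha, _, rfl, hab⟩ := hm
  rw [← Algebra.algebraMap_eq_smul_one, ← hab]
  exact sub_pos.2 (hc.trans_le (csInf_le (A.finite_spectrum).bddBelow ha))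

end Eigenvalues

theorem leftInv_mul_self {k l : ℕ} {A : Matrix (Fin k) (Fin l) ℝ} (hA : A.rank = l) :
    leftInv A * A = 1 := by
  have hcols : LinearIndependent ℝ A.col := by
    rw [linearIndependent_iff_card_eq_finrank_span, Set.finrank, ← rank_eq_finrank_span_cols, hA,
      Fintype.card_fin]
  have hpos : (Aᵀ * A).PosDef := by
    simpa only [conjTranspose_eq_transpose_of_trivial] using
      PosDef.conjTranspose_mul_self A (mulVec_injective_iff.2 hcols)
  rw [leftInv, Matrix.mul_assoc, nonsing_inv_mul _ hpos.det_pos.ne'.isUnit]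

/-! ### Exponential decay of the matrix exponential of a Hurwitz matrix -/

section Decay

open scoped Matrix.Norms.Operator Nat

variable {ι : Type*} [Fintype ι] [DecidableEq ι]

theorem exp_mulVec_eq_sum_range {N : Matrix ι ι ℂ} {v : ι → ℂ} {K : ℕ} (h : N ^ K *ᵥ v = 0) :
    NormedSpace.exp N *ᵥ v = ∑ j ∈ Finset.range K, ((j !⁻¹ : ℂ) • N ^ j) *ᵥ v := by
  have hsum : HasSum (fun j => ((j !⁻¹ : ℂ) • N ^ j) *ᵥ v) (NormedSpace.exp N *ᵥ v) :=
    (NormedSpace.exp_series_hasSum_exp' (𝕂 := ℂ) N).map (Matrix.mulVec.addMonoidHomLeft v)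
      (continuous_id.matrix_mulVec continuous_const)
  refine hsum.unique (hasSum_sum_of_ne_finset_zero fun j hj => ?_)
  obtain ⟨i, rfl⟩ := Nat.exists_eq_add_of_le' (not_lt.1 (Finset.mem_range.not.1 hj))
  rw [smul_mulVec, pow_add, ← mulVec_mulVec, h, mulVec_zero, smul_zero]

theorem exp_smul_eq_cexp_smul_exp_sub (A : Matrix ι ι ℂ) (μ t : ℂ) :
    NormedSpace.exp (t • A) = Complex.exp (t * μ) • NormedSpace.exp (t • (A - μ • 1)) := by
  have hsplit : t • A = algebraMap ℂ (Matrix ι ι ℂ) (t * μ) + t • (A - μ • 1) := by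
    rw [Algebra.algebraMap_eq_smul_one, smul_sub, smul_smul]
    abel
  have hscalar : NormedSpace.exp (algebraMap ℂ (Matrix ι ι ℂ) (t * μ)) =
      algebraMap ℂ _ (Complex.exp (t * μ)) := by
    rw [Complex.exp_eq_exp_ℂ]
    exact (NormedSpace.algebraMap_exp_comm (𝔸 := Matrix ι ι ℂ) _).symm
  rw [hsplit, Matrix.exp_add_of_commute _ _ (Algebra.commute_algebraMap_left _ _), hscalar,
    ← Algebra.smul_def]

theorem pow_div_factorial_le_exp_mul {δ t : ℝ} (hδ : 0 < δ) (ht : 0 ≤ t) (j : ℕ) :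
    t ^ j / j ! ≤ (δ ^ j)⁻¹ * Real.exp (δ * t) := by
  rw [inv_mul_eq_div, le_div_iff₀ (pow_pos hδ j)]
  calc t ^ j / j ! * δ ^ j = (δ * t) ^ j / j ! := by ring
    _ ≤ Real.exp (δ * t) := Real.pow_div_factorial_le_exp _ (mul_nonneg hδ.le ht) j

theorem norm_exp_smul_mulVec_le_of_pow_mulVec_eq_zero {N : Matrix ι ι ℂ} {v : ι → ℂ} {K : ℕ}
    (h : N ^ K *ᵥ v = 0) {δ t : ℝ} (hδ : 0 < δ) (ht : 0 ≤ t) :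
    ‖NormedSpace.exp ((t : ℂ) • N) *ᵥ v‖ ≤
      (∑ j ∈ Finset.range K, (δ ^ j)⁻¹ * ‖N ^ j *ᵥ v‖) * Real.exp (δ * t) := by
  have hK : ((t : ℂ) • N) ^ K *ᵥ v = 0 := by rw [smul_pow, smul_mulVec, h, smul_zero]
  rw [exp_mulVec_eq_sum_range hK, Finset.sum_mul]
  refine norm_sum_le_of_le _ fun j _ => ?_
  calc ‖((j !⁻¹ : ℂ) • ((t : ℂ) • N) ^ j) *ᵥ v‖ = t ^ j / j ! * ‖N ^ j *ᵥ v‖ := by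
        rw [smul_pow, smul_mulVec, smul_mulVec, norm_smul, norm_smul, norm_inv,
          Complex.norm_natCast, norm_pow, Complex.norm_real, Real.norm_of_nonneg ht]
        ring
    _ ≤ (δ ^ j)⁻¹ * Real.exp (δ * t) * ‖N ^ j *ᵥ v‖ := by
        gcongr
        exact pow_div_factorial_le_exp_mul hδ ht j
    _ = (δ ^ j)⁻¹ * ‖N ^ j *ᵥ v‖ * Real.exp (δ * t) := by ring

theorem exists_norm_exp_smul_mulVec_le_of_genEigenvector {A : Matrix ι ι ℂ} {μ : ℂ} {c : ℝ}
    (hμ : μ.re < -c) {v : ι → ℂ} {K : ℕ} (h : (A - μ • 1) ^ K *ᵥ v = 0) :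
    ∃ C : ℝ, ∀ t : ℝ, 0 ≤ t →
      ‖NormedSpace.exp ((t : ℂ) • A) *ᵥ v‖ ≤ C * Real.exp (-c * t) := by
  refine ⟨∑ j ∈ Finset.range K, ((-c - μ.re) ^ j)⁻¹ * ‖(A - μ • 1) ^ j *ᵥ v‖, fun t ht => ?_⟩
  rw [exp_smul_eq_cexp_smul_exp_sub A μ, smul_mulVec, norm_smul, Complex.norm_exp,
    Complex.re_ofReal_mul]
  refine (mul_le_mul_of_nonneg_left (norm_exp_smul_mulVec_le_of_pow_mulVec_eq_zero h
    (δ := -c - μ.re) (by linarith) ht) (Real.exp_nonneg _)).trans_eq ?_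
  rw [mul_left_comm, ← Real.exp_add]
  ring_nf

theorem exists_norm_exp_smul_mulVec_le {A : Matrix ι ι ℂ} {c : ℝ}
    (hA : ∀ μ ∈ spectrum ℂ A, μ.re < -c) (v : ι → ℂ) :
    ∃ C : ℝ, ∀ t : ℝ, 0 ≤ t →
      ‖NormedSpace.exp ((t : ℂ) • A) *ᵥ v‖ ≤ C * Real.exp (-c * t) := by
  have hv : v ∈ ⨆ μ, Module.End.maxGenEigenspace (toLin' A) μ := by
    rw [Module.End.iSup_maxGenEigenspace_eq_top]
    exact Submodule.mem_top
  induction hv using Submodule.iSup_induction' with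
  | mem μ w hw =>
    obtain ⟨K, hK⟩ := (Module.End.mem_maxGenEigenspace _ _ _).1 hw
    rcases eq_or_ne w 0 with rfl | hw0
    · exact ⟨0, fun t _ => by simp⟩
    have hμ : μ ∈ spectrum ℂ A := by
      rw [← spectrum_toLin', ← Module.End.hasEigenvalue_iff_mem_spectrum]
      refine Module.End.hasEigenvalue_of_hasGenEigenvalue (k := K) fun hbot => hw0 ?_
      exact (Submodule.mem_bot ℂ).1 (hbot ▸ Module.End.mem_genEigenspace_nat.2 hK)
    refine exists_norm_exp_smul_mulVec_le_of_genEigenvector (hA μ hμ) (K := K) ?_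
    rwa [← toLin'_apply, toLin'_pow, map_sub, map_smul, toLin'_one]
  | zero => exact ⟨0, fun t _ => by simp⟩
  | add w₁ w₂ _ _ h₁ h₂ =>
    obtain ⟨⟨C₁, h₁⟩, C₂, h₂⟩ := And.intro h₁ h₂
    refine ⟨C₁ + C₂, fun t ht => ?_⟩
    rw [mulVec_add, add_mul]
    exact norm_add_le_of_le (h₁ t ht) (h₂ t ht)

theorem map_exp_smul (A : Matrix ι ι ℝ) (t : ℝ) :
    (NormedSpace.exp (t • A)).map (algebraMap ℝ ℂ) =
      NormedSpace.exp ((t : ℂ) • A.map (algebraMap ℝ ℂ)) := by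
  have hsmul : (algebraMap ℝ ℂ).mapMatrix (t • A) = (t : ℂ) • A.map (algebraMap ℝ ℂ) := by
    ext i j
    simp
  exact (NormedSpace.map_exp (algebraMap ℝ ℂ).mapMatrix
    (continuous_id.matrix_map (continuous_algebraMap ℝ ℂ)) (t • A)).trans (by rw [hsmul]; rfl)

theorem IsHurwitz.exists_re_lt_neg {k : ℕ} {A : Matrix (Fin k) (Fin k) ℝ} (hA : IsHurwitz A) :
    ∃ c > 0, ∀ μ ∈ spectrum ℂ (A.map (algebraMap ℝ ℂ)), μ.re < -c := by
  rcases (spectrum ℂ (A.map (algebraMap ℝ ℂ))).eq_empty_or_nonempty with hempty | hne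
  · exact ⟨1, one_pos, fun μ hμ => absurd hμ (hempty ▸ notMem_empty μ)⟩
  · obtain ⟨μ₀, hμ₀, hmax⟩ := exists_max_image _ Complex.re (Matrix.finite_spectrum _) hne
    refine ⟨-μ₀.re / 2, by linarith [hA μ₀ hμ₀], fun μ hμ => ?_⟩
    linarith [hA μ₀ hμ₀, hmax μ hμ]

theorem IsHurwitz.exists_abs_exp_smul_apply_le {k : ℕ} {A : Matrix (Fin k) (Fin k) ℝ}
    (hA : IsHurwitz A) :
    ∃ c > 0, ∃ C : ℝ, ∀ t : ℝ, 0 ≤ t → ∀ i j,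
      |NormedSpace.exp (t • A) i j| ≤ C * Real.exp (-c * t) := by
  obtain ⟨c, hc, hspec⟩ := hA.exists_re_lt_neg
  choose C hC using fun j => exists_norm_exp_smul_mulVec_le hspec (Pi.single j (1 : ℂ))
  refine ⟨c, hc, ∑ j, |C j|, fun t ht i j => ?_⟩
  have hij := (norm_le_pi_norm _ i).trans (hC j t ht)
  rw [← map_exp_smul, mulVec_single_one] at hij
  simp only [col_apply, map_apply, Complex.coe_algebraMap, Complex.norm_real,
    Real.norm_eq_abs] at hij
  refine hij.trans (mul_le_mul_of_nonneg_right ?_ (Real.exp_nonneg _))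
  exact (le_abs_self _).trans
    (Finset.single_le_sum (f := fun j => |C j|) (fun _ _ => abs_nonneg _) (Finset.mem_univ j))

end Decay

/-! ### Linear filters -/

section Filters

open scoped Matrix.Norms.Operator
open MeasureTheory

section MulVec

variable {ι κ : Type*} [Fintype κ] {s : Set ℝ} {t : ℝ}

theorem continuousOn_mulVec {M : ℝ → Matrix ι κ ℝ} {z : ℝ → κ → ℝ} (hM : ContinuousOn M s)
    (hz : ContinuousOn z s) : ContinuousOn (fun r => M r *ᵥ z r) s :=
  (continuous_fst.matrix_mulVec continuous_snd).comp_continuousOn (hM.prodMk hz)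

variable [Finite ι]

theorem hasDerivWithinAt_mulVec {M : ℝ → Matrix ι κ ℝ} {M' : Matrix ι κ ℝ} {z : ℝ → κ → ℝ}
    {z' : κ → ℝ} (hM : HasDerivWithinAt M M' s t) (hz : HasDerivWithinAt z z' s t) :
    HasDerivWithinAt (fun r => M r *ᵥ z r) (M' *ᵥ z t + M t *ᵥ z') s t := by
  cases nonempty_fintype ι
  rw [add_comm]
  exact (mulVecBilin ℝ ℝ).toContinuousBilinearMap.hasDerivWithinAt_of_bilinear hM hz

theorem hasDerivWithinAt_const_mulVec (M : Matrix ι κ ℝ) {z : ℝ → κ → ℝ} {z' : κ → ℝ}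
    (hz : HasDerivWithinAt z z' s t) : HasDerivWithinAt (fun r => M *ᵥ z r) (M *ᵥ z') s t :=
  have := Fintype.ofFinite ι
  M.mulVecLin.toContinuousLinearMap.hasFDerivAt.comp_hasDerivWithinAt t hz

end MulVec

variable {k l q : ℕ}

theorem continuous_exp_smul (A : Matrix (Fin k) (Fin k) ℝ) :
    Continuous fun t : ℝ => NormedSpace.exp (t • A) :=
  NormedSpace.exp_continuous.comp (continuous_id.smul continuous_const)

theorem l1Norm_nonneg (A : Matrix (Fin k) (Fin k) ℝ) (B : Matrix (Fin k) (Fin l) ℝ)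
    (C : Matrix (Fin q) (Fin k) ℝ) : 0 ≤ l1Norm A B C :=
  Real.iSup_nonneg fun _ => Finset.sum_nonneg fun _ _ => integral_nonneg fun _ => abs_nonneg _

/-- The impulse response `C e^{tA} B` of the strictly proper filter `(A, B, C)`, the kernel through
which its output depends on its input. -/
noncomputable def impulseResponse (A : Matrix (Fin k) (Fin k) ℝ) (B : Matrix (Fin k) (Fin l) ℝ)
    (C : Matrix (Fin q) (Fin k) ℝ) (t : ℝ) : Matrix (Fin q) (Fin l) ℝ :=
  C * NormedSpace.exp (t • A) * B

variable {A : Matrix (Fin k) (Fin k) ℝ} {B : Matrix (Fin k) (Fin l) ℝ}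
  {C : Matrix (Fin q) (Fin k) ℝ}

theorem continuous_impulseResponse : Continuous (impulseResponse A B C) :=
  (continuous_const.matrix_mul (continuous_exp_smul A)).matrix_mul continuous_const

theorem IsHurwitz.integrableOn_exp_smul_apply (hA : IsHurwitz A) (i j : Fin k) :
    IntegrableOn (fun t : ℝ => NormedSpace.exp (t • A) i j) (Ioi 0) := by
  obtain ⟨c, hc, M, hM⟩ := hA.exists_abs_exp_smul_apply_le
  have hdom : IntegrableOn (fun t : ℝ => M * Real.exp (-c * t)) (Ioi 0) :=
    (integrableOn_exp_mul_Ioi (neg_lt_zero.2 hc) 0).const_mul M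
  refine hdom.mono' ((continuous_exp_smul A).matrix_elem i j).aestronglyMeasurable ?_
  filter_upwards [ae_restrict_mem measurableSet_Ioi] with t ht
  exact hM t (le_of_lt ht) i j

theorem IsHurwitz.integrableOn_impulseResponse_apply (hA : IsHurwitz A) (i : Fin q) (j : Fin l) :
    IntegrableOn (fun t => impulseResponse A B C t i j) (Ioi 0) := by
  simp only [impulseResponse, mul_apply]
  exact integrable_finsetSum _ fun a _ => (integrable_finsetSum _ fun b _ =>
    (hA.integrableOn_exp_smul_apply b a).const_mul _).mul_const _

theorem mulVec_eq_integral_impulseResponse {z : ℝ → Fin k → ℝ} {w : ℝ → Fin l → ℝ} {t : ℝ}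
    (ht : 0 ≤ t) (hz0 : z 0 = 0)
    (hz : ∀ s ∈ Icc 0 t, HasDerivWithinAt z (A *ᵥ z s + B *ᵥ w s) (Icc 0 t) s)
    (hw : ContinuousOn w (Icc 0 t)) :
    C *ᵥ z t = ∫ s in (0 : ℝ)..t, impulseResponse A B C (t - s) *ᵥ w s := by
  have hderiv : ∀ s ∈ Icc 0 t, HasDerivWithinAt
      (fun r => C *ᵥ (NormedSpace.exp ((t - r) • A) *ᵥ z r))
      (impulseResponse A B C (t - s) *ᵥ w s) (Icc 0 t) s := by
    intro s hs
    have hexp := ((hasDerivAt_exp_smul_const A (t - s)).scomp s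
      ((hasDerivAt_id s).const_sub t)).hasDerivWithinAt (s := Icc 0 t)
    refine (hasDerivWithinAt_const_mulVec C
      (hasDerivWithinAt_mulVec hexp (hz s hs))).congr_deriv ?_
    simp only [impulseResponse, Function.comp_apply, neg_one_smul, neg_mulVec, mulVec_add,
      mulVec_mulVec, Matrix.mul_assoc, mulVec_neg]
    abel
  have hint : IntervalIntegrable (fun s => impulseResponse A B C (t - s) *ᵥ w s) volume 0 t :=
    ContinuousOn.intervalIntegrable_of_Icc ht
      (continuousOn_mulVec (continuous_impulseResponse.comp
        (continuous_const.sub continuous_id)).continuousOn hw)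
  rw [intervalIntegral.integral_eq_sub_of_hasDerivAt_of_le ht
    (fun s hs => (hderiv s hs).continuousWithinAt)
    (fun s hs => (hderiv s (Ioo_subset_Icc_self hs)).hasDerivAt (Icc_mem_nhds hs.1 hs.2)) hint]
  simp [hz0]

theorem integral_abs_comp_sub_le {h : ℝ → ℝ} (hh : IntegrableOn h (Ioi 0)) {t : ℝ} (ht : 0 ≤ t) :
    ∫ s in (0 : ℝ)..t, |h (t - s)| ≤ ∫ s in Ioi (0 : ℝ), |h s| := by
  rw [intervalIntegral.integral_comp_sub_left (fun s => |h s|) t, sub_self, sub_zero,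
    intervalIntegral.integral_of_le ht]
  exact setIntegral_mono_set hh.abs (Filter.Eventually.of_forall fun _ => abs_nonneg _)
    Ioc_subset_Ioi_self.eventuallyLE

theorem IsHurwitz.integral_sum_abs_impulseResponse_le_l1Norm (hA : IsHurwitz A) (i : Fin q) {t : ℝ}
    (ht : 0 ≤ t) :
    ∫ s in (0 : ℝ)..t, ∑ j, |impulseResponse A B C (t - s) i j| ≤ l1Norm A B C := by
  have hcont : ∀ j, Continuous fun s => |impulseResponse A B C (t - s) i j| := fun j =>
    ((continuous_impulseResponse.comp (continuous_const.sub continuous_id)).matrix_elem i j).abs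
  rw [intervalIntegral.integral_finsetSum fun j _ => (hcont j).intervalIntegrable _ _]
  refine (Finset.sum_le_sum fun j _ =>
    integral_abs_comp_sub_le (hA.integrableOn_impulseResponse_apply i j) ht).trans ?_
  exact le_ciSup (f := fun i => ∑ j, ∫ t in Ioi (0 : ℝ), |impulseResponse A B C t i j|)
    (finite_range _).bddAbove i

theorem IsHurwitz.norm_mulVec_le_l1Norm_mul (hA : IsHurwitz A) {z : ℝ → Fin k → ℝ}
    {w : ℝ → Fin l → ℝ} {τ ρ : ℝ} (hz0 : z 0 = 0)
    (hz : ∀ t ∈ Icc 0 τ, HasDerivWithinAt z (A *ᵥ z t + B *ᵥ w t) (Icc 0 τ) t)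
    (hw : ContinuousOn w (Icc 0 τ)) (hρ : ∀ t ∈ Icc 0 τ, ‖w t‖ ≤ ρ) {t : ℝ} (ht : t ∈ Icc 0 τ) :
    ‖C *ᵥ z t‖ ≤ l1Norm A B C * ρ := by
  have hsub : Icc 0 t ⊆ Icc 0 τ := Icc_subset_Icc_right ht.2
  have hρ0 : 0 ≤ ρ := (norm_nonneg _).trans (hρ t ht)
  have hcont : Continuous fun s => impulseResponse A B C (t - s) :=
    continuous_impulseResponse.comp (continuous_const.sub continuous_id)
  rw [mulVec_eq_integral_impulseResponse ht.1 hz0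
    (fun s hs => (hz s (hsub hs)).mono hsub) (hw.mono hsub)]
  refine (pi_norm_le_iff_of_nonneg (mul_nonneg (l1Norm_nonneg A B C) hρ0)).2 fun i => ?_
  have happly : (∫ s in (0 : ℝ)..t, impulseResponse A B C (t - s) *ᵥ w s) i =
      ∫ s in (0 : ℝ)..t, (impulseResponse A B C (t - s) *ᵥ w s) i :=
    ((ContinuousLinearMap.proj (R := ℝ) (φ := fun _ : Fin q => ℝ) i).intervalIntegral_comp_comm
      ((continuousOn_mulVec hcont.continuousOn (hw.mono hsub)).intervalIntegrable_of_Icc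
        ht.1)).symm
  calc ‖(∫ s in (0 : ℝ)..t, impulseResponse A B C (t - s) *ᵥ w s) i‖
      ≤ ∫ s in (0 : ℝ)..t, (∑ j, |impulseResponse A B C (t - s) i j|) * ρ := by
        rw [happly]
        refine intervalIntegral.norm_integral_le_of_norm_le ht.1
          (Filter.Eventually.of_forall fun s hs => ?_) ?_
        · exact abs_mulVec_apply_le _ (hρ s (hsub (Ioc_subset_Icc_self hs))) i
        · exact ((continuous_finsetSum _ fun j _ => (hcont.matrix_elem i j).abs).mul
            continuous_const).intervalIntegrable _ _
    _ ≤ l1Norm A B C * ρ := by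
        rw [intervalIntegral.integral_mul_const]
        exact mul_le_mul_of_nonneg_right
          (hA.integral_sum_abs_impulseResponse_le_l1Norm i ht.1) hρ0

theorem exists_linear_ode_solution (A : Matrix (Fin k) (Fin k) ℝ) (B : Matrix (Fin k) (Fin l) ℝ)
    {w : ℝ → Fin l → ℝ} {τ : ℝ} (hτ : 0 ≤ τ) (hw : ContinuousOn w (Icc 0 τ)) :
    ∃ z : ℝ → Fin k → ℝ, z 0 = 0 ∧
      ∀ t ∈ Icc 0 τ, HasDerivWithinAt z (A *ᵥ z t + B *ᵥ w t) (Icc 0 τ) t := by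
  let wExt : ℝ → Fin l → ℝ := IccExtend hτ ((Icc 0 τ).domRestrict w)
  have hwExt : Continuous wExt := (continuousOn_iff_continuous_domRestrict.1 hw).Icc_extend'
  let g : ℝ → Fin k → ℝ := fun s => NormedSpace.exp ((-s) • A) *ᵥ (B *ᵥ wExt s)
  have hg : Continuous g := ((continuous_exp_smul A).comp continuous_neg).matrix_mulVec
    (continuous_const.matrix_mulVec hwExt)
  refine ⟨fun t => NormedSpace.exp (t • A) *ᵥ ∫ s in (0 : ℝ)..t, g s, by simp, fun t ht => ?_⟩
  have hint : HasDerivWithinAt (fun t => ∫ s in (0 : ℝ)..t, g s) (g t) (Icc 0 τ) t :=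
    (hg.integral_hasStrictDerivAt 0 t).hasDerivAt.hasDerivWithinAt
  refine (hasDerivWithinAt_mulVec
    (hasDerivAt_exp_smul_const' A t).hasDerivWithinAt hint).congr_deriv ?_
  have hinv : NormedSpace.exp (t • A) * NormedSpace.exp ((-t) • A) = 1 := by
    rw [← Matrix.exp_add_of_commute _ _ (((Commute.refl A).smul_left t).smul_right (-t)),
      ← add_smul, add_neg_cancel, zero_smul, NormedSpace.exp_zero]
  have hgt : NormedSpace.exp (t • A) *ᵥ g t = B *ᵥ w t := by
    rw [mulVec_mulVec, hinv, one_mulVec, show wExt t = w t from IccExtend_of_mem hτ _ ht]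
  exact congrArg₂ (· + ·) (mulVec_mulVec _ _ _).symm hgt

end Filters

/-! ### Differential inequalities -/

section Comparison

open scoped Topology

theorem hasDerivWithinAt_Ici_of_Icc {E : Type*} [NormedAddCommGroup E] [NormedSpace ℝ E]
    {f : ℝ → E} {f' : E} {a b x : ℝ} (hx : x ∈ Ico a b) (h : HasDerivWithinAt f f' (Icc a b) x) :
    HasDerivWithinAt f f' (Ici x) x :=
  h.mono_of_mem_nhdsWithin (Icc_mem_nhdsGE_of_mem hx)

theorem le_of_deriv_nonpos_above {h h' : ℝ → ℝ} {a b c : ℝ}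
    (hd : ∀ t ∈ Icc a b, HasDerivWithinAt h (h' t) (Icc a b) t) (ha : h a ≤ c)
    (hc : ∀ t ∈ Icc a b, c < h t → h' t ≤ 0) {t : ℝ} (ht : t ∈ Icc a b) : h t ≤ c := by
  have hslope : ∀ δ > 0, h t ≤ c + δ * (1 + (t - a)) := by
    intro δ hδ
    refine image_le_of_deriv_right_lt_deriv_boundary' (B := fun s => c + δ * (1 + (s - a)))
      (B' := fun _ => δ) (fun s hs => (hd s hs).continuousWithinAt)
      (fun s hs => hasDerivWithinAt_Ici_of_Icc hs (hd s (Ico_subset_Icc_self hs))) (by linarith)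
      (by fun_prop) (fun s _ => ?_) (fun s hs hsc => ?_) ht
    · simpa using (((((hasDerivAt_id s).sub_const a).const_add 1).const_mul δ).const_add
        c).hasDerivWithinAt (s := Ici s)
    · have : 0 < δ * (1 + (s - a)) := mul_pos hδ (by linarith [hs.1])
      exact (hc s (Ico_subset_Icc_self hs) (by linarith)).trans_lt hδ
  refine le_of_forall_pos_le_add fun η hη => ?_
  have hpos : 0 < 1 + (t - a) := by linarith [ht.1]
  simpa only [div_mul_cancel₀ _ hpos.ne'] using hslope (η / (1 + (t - a))) (by positivity)

/-- The upper right Dini derivative of `V` at `x` is at most `a`. This is the form of the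
differential inequality available for Lyapunov functions containing parameters that are Lipschitz
in time but need not be differentiable. -/
def RightDiniLE (V : ℝ → ℝ) (a x : ℝ) : Prop :=
  ∀ r, a < r → ∀ᶠ z in 𝓝[>] x, slope V x z < r

variable {U V : ℝ → ℝ} {a b x : ℝ}

theorem rightDiniLE_of_hasDerivWithinAt (h : HasDerivWithinAt V a (Ici x) x) :
    RightDiniLE V a x :=
  fun _ hr => h.Ioi_of_Ici.limsup_slope_le' (lt_irrefl x) hr

namespace RightDiniLE

theorem mono (h : RightDiniLE V a x) (hab : a ≤ b) : RightDiniLE V b x :=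
  fun r hr => h r (hab.trans_lt hr)

theorem add (hU : RightDiniLE U a x) (hV : RightDiniLE V b x) :
    RightDiniLE (fun t => U t + V t) (a + b) x := by
  intro r hr
  filter_upwards [hU (a + (r - (a + b)) / 2) (by linarith),
    hV (b + (r - (a + b)) / 2) (by linarith)] with z hUz hVz
  calc slope (fun t => U t + V t) x z = slope U x z + slope V x z := by
        simp only [slope_def_field]; ring
    _ < r := by linarith

theorem div_const (hV : RightDiniLE V a x) {c : ℝ} (hc : 0 < c) :
    RightDiniLE (fun t => V t / c) (a / c) x := by
  intro r hr
  filter_upwards [hV (r * c) ((div_lt_iff₀ hc).1 hr)] with z hz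
  calc slope (fun t => V t / c) x z = slope V x z / c := by
        simp only [slope_def_field]; ring
    _ < r := (div_lt_iff₀ hc).2 hz

theorem of_le (hU : RightDiniLE U a x) (hx : U x = V x) (hle : ∀ᶠ z in 𝓝[>] x, V z ≤ U z) :
    RightDiniLE V a x := by
  intro r hr
  filter_upwards [hU r hr, hle, self_mem_nhdsWithin] with z hz hVU hxz
  refine lt_of_le_of_lt ?_ hz
  rw [slope_def_field, slope_def_field, hx]
  have : 0 < z - x := sub_pos.2 hxz
  gcongr

theorem le_add_mul_exp {τ lam c : ℝ} (hV : ContinuousOn V (Icc 0 τ))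
    (hV' : ∀ x ∈ Ico 0 τ, RightDiniLE V (-lam * (V x - c)) x) {t : ℝ} (ht : t ∈ Icc 0 τ) :
    V t ≤ c + (V 0 - c) * Real.exp (-lam * t) := by
  have h := le_gronwallBound_of_liminf_deriv_right_le (f := fun s => V s - c)
    (f' := fun s => -lam * (V s - c)) (δ := V 0 - c) (K := -lam) (ε := 0)
    (hV.sub continuousOn_const)
    (fun x hx r hr => ((hV' x hx r hr).mono fun z hz => ?_).frequently) le_rfl
    (fun x _ => (add_zero _).ge) t ht
  · rw [gronwallBound_ε0, sub_zero] at h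
    linarith
  · rwa [sub_sub_sub_cancel_right, ← div_eq_inv_mul, ← slope_def_field]

end RightDiniLE

theorem hasDerivWithinAt_dotProduct {ι : Type*} [Fintype ι] {v w : ℝ → ι → ℝ} {v' w' : ι → ℝ}
    {s : Set ℝ} {t : ℝ} (hv : HasDerivWithinAt v v' s t) (hw : HasDerivWithinAt w w' s t) :
    HasDerivWithinAt (fun r => v r ⬝ᵥ w r) (v' ⬝ᵥ w t + v t ⬝ᵥ w') s t := by
  have h := HasDerivWithinAt.fun_sum (u := Finset.univ) fun j _ =>
    (hasDerivWithinAt_pi.1 hv j).fun_mul (hasDerivWithinAt_pi.1 hw j)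
  exact h.congr_deriv Finset.sum_add_distrib

theorem hasDerivWithinAt_quadraticForm {ι : Type*} [Fintype ι] {P : Matrix ι ι ℝ} (hP : Pᵀ = P)
    {v : ℝ → ι → ℝ} {v' : ι → ℝ} {s : Set ℝ} {t : ℝ} (hv : HasDerivWithinAt v v' s t) :
    HasDerivWithinAt (fun r => v r ⬝ᵥ (P *ᵥ v r)) (2 * (v t ⬝ᵥ (P *ᵥ v'))) s t := by
  refine (hasDerivWithinAt_dotProduct hv (hasDerivWithinAt_const_mulVec P hv)).congr_deriv ?_
  rw [dotProduct_mulVec, ← mulVec_transpose, hP, dotProduct_comm]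
  ring

end Comparison

/-! ### Adaptive laws with the smooth projection operator -/

section Projection

open scoped Topology

variable {E : Type} [NormedAddCommGroup E] [InnerProductSpace ℝ E] {ε R Γ L τ : ℝ}

theorem inner_sub_smoothProj_sub_nonpos (hε : 0 < ε) (hR : 0 < R) {c θ θs : E} (y : E)
    (hs : ‖θs - c‖ ≤ R) : inner ℝ (θ - θs) (smoothProj ε c R θ y - y) ≤ 0 := by
  rw [smoothProj]
  split_ifs with h
  · obtain ⟨hg, hinner⟩ := h
    have hRθ : R ^ 2 ≤ ‖θ - c‖ ^ 2 := by
      rwa [le_div_iff₀ (by positivity), zero_mul, sub_nonneg] at hg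
    have houtward : 0 ≤ inner ℝ (θ - θs) (θ - c) := by
      rw [← sub_sub_sub_cancel_right θ θs c, inner_sub_left, real_inner_self_eq_norm_sq, sub_nonneg]
      calc inner ℝ (θs - c) (θ - c) ≤ ‖θs - c‖ * ‖θ - c‖ := real_inner_le_norm _ _
        _ ≤ ‖θ - c‖ ^ 2 := by
          rw [sq]
          gcongr
          exact hs.trans (le_of_sq_le_sq hRθ (norm_nonneg _))
    rw [sub_sub_cancel_left, inner_neg_right, inner_smul_right, neg_nonpos]
    positivity
  · rw [sub_self, inner_zero_right]

theorem inner_smoothProj_nonpos (hε : 0 < ε) (hR : 0 < R) {c θ : E} (y : E)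
    (hθ : (1 + ε) * R ^ 2 < ‖θ - c‖ ^ 2) : inner ℝ (θ - c) (smoothProj ε c R θ y) ≤ 0 := by
  have hg : 1 ≤ (‖θ - c‖ ^ 2 - R ^ 2) / (ε * R ^ 2) :=
    (one_le_div₀ (by positivity)).2 (by linarith)
  rw [smoothProj]
  split_ifs with h
  · have hne : ‖θ - c‖ ^ 2 ≠ 0 := ((by positivity : 0 < (1 + ε) * R ^ 2).trans hθ).ne'
    rw [inner_sub_right, inner_smul_right, real_inner_self_eq_norm_sq, div_mul_cancel₀ _ hne,
      sub_nonpos]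
    exact le_mul_of_one_le_left h.2.le hg
  · exact not_lt.1 fun hinner => h ⟨zero_le_one.trans hg, hinner⟩

theorem norm_sub_sq_le_of_smoothProj_ode (hε : 0 < ε) (hR : 0 < R) (hΓ : 0 < Γ) {c : E}
    {θh y : ℝ → E} (h0 : ‖θh 0 - c‖ ≤ R)
    (hd : ∀ t ∈ Icc 0 τ, HasDerivWithinAt θh (Γ • smoothProj ε c R (θh t) (y t)) (Icc 0 τ) t)
    {t : ℝ} (ht : t ∈ Icc 0 τ) : ‖θh t - c‖ ^ 2 ≤ (1 + ε) * R ^ 2 := by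
  refine le_of_deriv_nonpos_above (h := fun t => ‖θh t - c‖ ^ 2)
    (fun s hs => ((hd s hs).sub_const c).norm_sq) ?_ (fun s _ hlt => ?_) ht
  · calc ‖θh 0 - c‖ ^ 2 ≤ R ^ 2 := by gcongr
      _ ≤ (1 + ε) * R ^ 2 := le_mul_of_one_le_left (sq_nonneg R) (by linarith)
  · rw [inner_smul_right]
    have := mul_nonpos_of_nonneg_of_nonpos hΓ.le (inner_smoothProj_nonpos hε hR (y s) hlt)
    linarith

theorem norm_sub_le_of_smoothProj_ode (hε : 0 < ε) (hR : 0 < R) (hΓ : 0 < Γ) {c θ : E}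
    {θh y : ℝ → E} (h0 : ‖θh 0 - c‖ ≤ R)
    (hd : ∀ t ∈ Icc 0 τ, HasDerivWithinAt θh (Γ • smoothProj ε c R (θh t) (y t)) (Icc 0 τ) t)
    (hθ : ‖θ - c‖ ≤ R) {t : ℝ} (ht : t ∈ Icc 0 τ) : ‖θh t - θ‖ ≤ (2 + ε) * R := by
  have hθh : ‖θh t - c‖ ≤ (1 + ε) * R := by
    refine le_of_sq_le_sq ((norm_sub_sq_le_of_smoothProj_ode hε hR hΓ h0 hd ht).trans ?_)
      (by positivity)
    rw [mul_pow]
    gcongr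
    nlinarith
  calc ‖θh t - θ‖ ≤ ‖θh t - c‖ + ‖θ - c‖ := by
        simpa only [dist_eq_norm] using dist_triangle_right (θh t) θ c
    _ ≤ (2 + ε) * R := by linarith

theorem rightDiniLE_norm_sub_sq {a θ : ℝ → E} {a' : E} {M x : ℝ}
    (ha : HasDerivWithinAt a a' (Ici x) x) (hM : ∀ᶠ z in 𝓝[>] x, ‖a z - θ x‖ ≤ M)
    (hL : ∀ᶠ z in 𝓝[>] x, ‖θ z - θ x‖ ≤ L * (z - x)) :
    RightDiniLE (fun z => ‖a z - θ z‖ ^ 2) (2 * inner ℝ (a x - θ x) a' + 2 * M * L) x := by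
  have hlin : HasDerivWithinAt (fun z => L * (z - x)) L (Ici x) x := by
    simpa using ((hasDerivWithinAt_id x _).sub_const x).const_mul L
  have hmaj : HasDerivWithinAt
      (fun z => ‖a z - θ x‖ ^ 2 + 2 * M * (L * (z - x)) + (L * (z - x)) ^ 2)
      (2 * inner ℝ (a x - θ x) a' + 2 * M * L) (Ici x) x :=
    (((ha.sub_const (θ x)).norm_sq.fun_add (hlin.const_mul (2 * M))).fun_add
      (hlin.fun_pow 2)).congr_deriv (by simp)
  refine (rightDiniLE_of_hasDerivWithinAt hmaj).of_le (by simp) ?_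
  filter_upwards [hM, hL] with z hMz hLz
  have htri : ‖a z - θ z‖ ≤ ‖a z - θ x‖ + L * (z - x) :=
    (norm_sub_le_norm_sub_add_norm_sub _ (θ x) _).trans (by rw [norm_sub_rev (θ x)]; gcongr)
  calc ‖a z - θ z‖ ^ 2 ≤ (‖a z - θ x‖ + L * (z - x)) ^ 2 := by gcongr
    _ = ‖a z - θ x‖ ^ 2 + 2 * ‖a z - θ x‖ * (L * (z - x)) + (L * (z - x)) ^ 2 := by ring
    _ ≤ _ := by
      have := (norm_nonneg _).trans hLz
      gcongr

theorem rightDiniLE_of_smoothProj_ode (hε : 0 < ε) (hR : 0 < R) (hΓ : 0 < Γ) {c : E}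
    {θh θ y : ℝ → E} (h0 : ‖θh 0 - c‖ ≤ R)
    (hd : ∀ t ∈ Icc 0 τ, HasDerivWithinAt θh (Γ • smoothProj ε c R (θh t) (y t)) (Icc 0 τ) t)
    (hθ : ∀ t ∈ Icc 0 τ, ‖θ t - c‖ ≤ R)
    (hL : ∀ t ∈ Icc 0 τ, ∀ t' ∈ Icc 0 τ, ‖θ t - θ t'‖ ≤ L * |t - t'|)
    {x : ℝ} (hx : x ∈ Ico 0 τ) :
    RightDiniLE (fun t => ‖θh t - θ t‖ ^ 2 / Γ)
      (2 * inner ℝ (θh x - θ x) (y x) + 2 * ((2 + ε) * R) * L / Γ) x := by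
  have hx' : x ∈ Icc 0 τ := Ico_subset_Icc_self hx
  have hright : ∀ᶠ z in 𝓝[>] x, z ∈ Ioc x τ := Ioc_mem_nhdsGT hx.2
  have hmem : ∀ z ∈ Ioc x τ, z ∈ Icc 0 τ := fun z hz => ⟨hx.1.trans hz.1.le, hz.2⟩
  refine ((rightDiniLE_norm_sub_sq (L := L) (hasDerivWithinAt_Ici_of_Icc hx (hd x hx'))
    (hright.mono fun z hz =>
      norm_sub_le_of_smoothProj_ode hε hR hΓ h0 hd (hθ x hx') (hmem z hz))
    (hright.mono fun z hz => ?_)).div_const hΓ).mono ?_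
  · simpa only [abs_of_pos (sub_pos.2 hz.1)] using hL z (hmem z hz) x hx'
  · have hproj := inner_sub_smoothProj_sub_nonpos hε hR (θ := θh x) (y x) (hθ x hx')
    rw [inner_sub_right] at hproj
    rw [add_div, inner_smul_right, mul_left_comm, mul_div_cancel_left₀ _ hΓ.ne']
    linarith

end Projection

section VecProj

variable {k : ℕ} {ε r Γ L τ : ℝ} {θh θ y : ℝ → Fin k → ℝ}

theorem hasDerivWithinAt_toLp_vecProj {R t : ℝ} {s : Set ℝ}
    (hd : HasDerivWithinAt θh (Γ • vecProj ε R (θh t) (y t)) s t) :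
    HasDerivWithinAt (fun t => (WithLp.toLp 2 (θh t) : EuclideanSpace ℝ (Fin k)))
      (Γ • smoothProj ε 0 R (WithLp.toLp 2 (θh t)) (WithLp.toLp 2 (y t))) s t :=
  (PiLp.continuousLinearEquiv 2 ℝ fun _ : Fin k => ℝ).symm.hasFDerivAt.comp_hasDerivWithinAt t hd

theorem dotProduct_sub_self_le_of_vecProj_ode (hε : 0 < ε) (hr : 0 < k → 0 < r) (hΓ : 0 < Γ)
    (h0 : θh 0 = 0)
    (hd : ∀ t ∈ Icc 0 τ, HasDerivWithinAt θh (Γ • vecProj ε (√k * r) (θh t) (y t)) (Icc 0 τ) t)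
    {ϑ : Fin k → ℝ} (hϑ : ‖ϑ‖ ≤ r) {t : ℝ} (ht : t ∈ Icc 0 τ) :
    (θh t - ϑ) ⬝ᵥ (θh t - ϑ) ≤ (2 + ε) ^ 2 * (k * r ^ 2) := by
  rcases k.eq_zero_or_pos with rfl | hk
  · simp
  rw [dotProduct_self_eq_norm_toLp_sq, WithLp.toLp_sub,
    show (2 + ε) ^ 2 * (k * r ^ 2) = ((2 + ε) * (√k * r)) ^ 2 by
      rw [mul_pow, mul_pow, Real.sq_sqrt k.cast_nonneg]]
  have : (0 : ℝ) < k := Nat.cast_pos.2 hk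
  have := hr hk
  gcongr
  exact norm_sub_le_of_smoothProj_ode (c := 0) hε (by positivity) hΓ
    (by rw [h0, WithLp.toLp_zero, sub_zero, norm_zero]; positivity)
    (fun s hs => hasDerivWithinAt_toLp_vecProj (hd s hs))
    (by simpa using norm_toLp_le_sqrt_card_mul hϑ) ht

theorem rightDiniLE_of_vecProj_ode (hε : 0 < ε) (hr : 0 < k → 0 < r) (hΓ : 0 < Γ)
    (h0 : θh 0 = 0)
    (hd : ∀ t ∈ Icc 0 τ, HasDerivWithinAt θh (Γ • vecProj ε (√k * r) (θh t) (y t)) (Icc 0 τ) t)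
    (hθ : ∀ t ∈ Icc 0 τ, ‖θ t‖ ≤ r)
    (hL : ∀ t ∈ Icc 0 τ, ∀ t' ∈ Icc 0 τ, ‖θ t - θ t'‖ ≤ L * |t - t'|)
    {x : ℝ} (hx : x ∈ Ico 0 τ) :
    RightDiniLE (fun t => (θh t - θ t) ⬝ᵥ (θh t - θ t) / Γ)
      (2 * ((θh x - θ x) ⬝ᵥ y x) + 2 * (2 + ε) * (k * (r * L)) / Γ) x := by
  rcases k.eq_zero_or_pos with rfl | hk
  · simpa using rightDiniLE_of_hasDerivWithinAt (hasDerivWithinAt_const x (Ici x) (0 : ℝ))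
  have hk' : (0 : ℝ) < k := Nat.cast_pos.2 hk
  have := hr hk
  have hdini := rightDiniLE_of_smoothProj_ode (c := 0) (θ := fun t => WithLp.toLp 2 (θ t))
    (L := √k * L) hε (by positivity) hΓ
    (by rw [h0, WithLp.toLp_zero, sub_zero, norm_zero]; positivity)
    (fun s hs => hasDerivWithinAt_toLp_vecProj (hd s hs))
    (fun s hs => by simpa using norm_toLp_le_sqrt_card_mul (hθ s hs))
    (fun s hs s' hs' => by
      simpa [mul_assoc] using norm_toLp_le_sqrt_card_mul (hL s hs s' hs')) hx
  simp only [← WithLp.toLp_sub, ← dotProduct_self_eq_norm_toLp_sq, ← dotProduct_eq_inner_toLp]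
    at hdini
  refine hdini.mono (le_of_eq ?_)
  congr 2
  linear_combination 2 * (2 + ε) * r * L * Real.sq_sqrt hk'.le

end VecProj

/-! ### Consequences of the design constraints -/

namespace Design

variable {n m p nz : ℕ} {S : Design n m p nz}

theorem Admissible.n_pos (hS : S.Admissible) : 0 < n := by
  refine Nat.pos_of_ne_zero fun hn => ?_
  subst hn
  have hlt := hS.εq_pos.trans hS.εq_lt
  rw [lambdaMin, show spectrum ℝ S.Q = ∅ from spectrum.of_subsingleton _, Real.sInf_empty] at hlt
  exact lt_irrefl _ hlt

theorem Admissible.isUnit_det_Az (hS : S.Admissible) : IsUnit S.Az.det := by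
  have hzero : (0 : ℂ) ∉ spectrum ℂ (S.Az.map (algebraMap ℝ ℂ)) := fun h =>
    lt_irrefl _ (hS.Az_hurwitz 0 h)
  rw [spectrum.zero_notMem_iff, isUnit_iff_isUnit_det, ← RingHom.mapMatrix_apply,
    ← RingHom.map_det] at hzero
  exact isUnit_iff_ne_zero.2 fun hdet => hzero.ne_zero (by rw [hdet, map_zero])

theorem Admissible.Cm_mul_Tz (hS : S.Admissible) : S.Cm * S.Tz = 0 := by
  have hmul : S.Cm * S.Tz * S.Az = 0 := by
    have h := hS.CmAmTz
    rwa [Matrix.mul_assoc, hS.AmTz, Matrix.mul_add, ← Matrix.mul_assoc, ← Matrix.mul_assoc,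
      add_eq_right] at h
  rw [← mul_nonsing_inv_cancel_right S.Az (S.Cm * S.Tz) hS.isUnit_det_Az, hmul, Matrix.zero_mul]

theorem Admissible.Cm_mulVec_Tz (hS : S.Admissible) (z : Fin nz → ℝ) :
    S.Cm *ᵥ (S.Tz *ᵥ z) = 0 := by
  rw [mulVec_mulVec, hS.Cm_mul_Tz, zero_mulVec]

theorem Admissible.Cz_or_Dz_ne_zero (hS : S.Admissible) (hm : 0 < m) : S.Cz ≠ 0 ∨ S.Dz ≠ 0 := by
  by_contra! h
  have : Nonempty (Fin m) := ⟨⟨0, hm⟩⟩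
  refine hS.pencil 0 ?_
  rw [h.1, h.2, Matrix.map_zero _ (map_zero _), Matrix.map_zero _ (map_zero _),
    det_fromBlocks_zero₂₁, det_zero, mul_zero]

theorem Admissible.Cz_mul_leftInv_ne_zero (hS : S.Admissible) (h : S.Cz ≠ 0) :
    S.Cz * leftInv S.Tz ≠ 0 := fun h0 => h <| by
  rw [← Matrix.mul_one S.Cz, ← leftInv_mul_self hS.rank_Tz, ← Matrix.mul_assoc, h0,
    Matrix.zero_mul]

theorem Tg_mulVec_sumElim (S : Design n m p nz) (ω : ℝ) (a : Fin n → ℝ) (b : Fin nz → ℝ) :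
    S.Tg ω *ᵥ Sum.elim a b = a + ω • (S.Tz *ᵥ b) := by
  rw [Tg, fromCols_mulVec_sumElim, one_mulVec, smul_mulVec]

theorem continuous_Tg (S : Design n m p nz) : Continuous S.Tg := by
  refine continuous_matrix fun i j => ?_
  rcases j with j | j
  · simp only [Tg, fromCols_apply_inl]; fun_prop
  · simp only [Tg, fromCols_apply_inr, Matrix.smul_apply, smul_eq_mul]; fun_prop

theorem Admissible.d_ρx_pos (hS : S.Admissible) : 0 < S.d S.ρx := hS.d_pos _ hS.ρx_pos

theorem le_dBar (S : Design n m p nz) {ω : ℝ} (hω : ω ∈ Icc S.ωl S.ωu) :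
    infNorm (S.Cz * leftInv S.Tz * S.Tg ω) + infNorm S.Dz * infNorm (S.Tg ω) * S.d S.ρx ≤
      S.dBar := by
  refine le_csSup ?_ (mem_image_of_mem _ hω)
  refine (isCompact_Icc.image ?_).bddAbove
  exact (continuous_infNorm.comp (continuous_const.matrix_mul S.continuous_Tg)).add
    ((continuous_const.mul (continuous_infNorm.comp S.continuous_Tg)).mul continuous_const)

theorem Admissible.dBar_nonneg (hS : S.Admissible) : 0 ≤ S.dBar := by
  refine le_trans ?_ (S.le_dBar hS.one_mem)
  positivity [infNorm_nonneg (S.Cz * leftInv S.Tz * S.Tg 1), infNorm_nonneg S.Dz,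
    infNorm_nonneg (S.Tg 1), hS.d_ρx_pos]

theorem Admissible.dBar_pos (hS : S.Admissible) (hm : 0 < m) : 0 < S.dBar := by
  refine lt_of_lt_of_le ?_ (S.le_dBar hS.one_mem)
  rcases hS.Cz_or_Dz_ne_zero hm with h | h
  · have hCz : S.Cz * leftInv S.Tz * S.Tg 1 ≠ 0 := fun h0 => by
      rw [Tg, mul_fromCols, Matrix.mul_one, ← fromCols_zero] at h0
      exact hS.Cz_mul_leftInv_ne_zero h (fromCols_inj h0).1
    positivity [infNorm_pos hCz, infNorm_nonneg S.Dz, infNorm_nonneg (S.Tg 1), hS.d_ρx_pos]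
  · have hTg : S.Tg 1 ≠ 0 := fun h0 => by
      have : Nonempty (Fin n) := ⟨⟨0, hS.n_pos⟩⟩
      rw [Tg, ← fromCols_zero] at h0
      exact one_ne_zero (fromCols_inj h0).1
    positivity [infNorm_nonneg (S.Cz * leftInv S.Tz * S.Tg 1), infNorm_pos h, infNorm_pos hTg,
      hS.d_ρx_pos]

theorem Admissible.bBar_nonneg (hS : S.Admissible) : 0 ≤ S.bBar := by
  rw [bBar]
  positivity [infNorm_nonneg (S.Cz * leftInv S.Tz), infNorm_nonneg S.Dz,
    l1Norm_nonneg S.Az S.Bz S.Tz, hS.d_ρx_pos, hS.ρx_pos, hS.b₀_pos]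

theorem Admissible.bBar_pos (hS : S.Admissible) (hm : 0 < m) : 0 < S.bBar := by
  have hl1 := l1Norm_nonneg S.Az S.Bz S.Tz
  rw [bBar]
  rcases hS.Cz_or_Dz_ne_zero hm with h | h
  · positivity [infNorm_pos (hS.Cz_mul_leftInv_ne_zero h), infNorm_nonneg S.Dz, hS.d_ρx_pos,
      hS.ρx_pos, hS.b₀_pos]
  · positivity [infNorm_nonneg (S.Cz * leftInv S.Tz), infNorm_pos h, hS.d_ρx_pos, hS.ρx_pos,
      hS.b₀_pos]

theorem Admissible.Am_mulVec_Tz (hS : S.Admissible) (z : Fin nz → ℝ) :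
    S.Am *ᵥ (S.Tz *ᵥ z) = S.Tz *ᵥ (S.Az *ᵥ z) + S.Bbar *ᵥ (S.Cz *ᵥ z) := by
  simp only [mulVec_mulVec, hS.AmTz, add_mulVec]

theorem Admissible.Bm_mulVec (hS : S.Admissible) (w : Fin m → ℝ) :
    S.Bm *ᵥ w = S.Tz *ᵥ (S.Bz *ᵥ w) + S.Bbar *ᵥ (S.Dz *ᵥ w) := by
  simp only [mulVec_mulVec, hS.Bm_eq, add_mulVec]

theorem Admissible.plant_field_eq (hS : S.Admissible) (ω : ℝ) (xv : Fin n → ℝ)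
    (xu xf : Fin nz → ℝ) (u F : Fin m → ℝ) :
    S.Am *ᵥ (xv + ω • (S.Tz *ᵥ xu) + S.Tz *ᵥ xf) + S.Bm *ᵥ (ω • u + F) =
      (S.Am *ᵥ xv + S.Bbar *ᵥ (ω • (S.Cz *ᵥ xu + S.Dz *ᵥ u) + (S.Cz *ᵥ xf + S.Dz *ᵥ F))) +
        ω • (S.Tz *ᵥ (S.Az *ᵥ xu + S.Bz *ᵥ u)) + S.Tz *ᵥ (S.Az *ᵥ xf + S.Bz *ᵥ F) := by
  simp only [mulVec_add, mulVec_smul, hS.Am_mulVec_Tz, hS.Bm_mulVec, smul_add]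
  abel

theorem Admissible.output_field_eq (hS : S.Admissible) (ω : ℝ) (xv : Fin n → ℝ)
    (xu xf : Fin nz → ℝ) (u F : Fin m → ℝ) :
    S.Cm *ᵥ (S.Am *ᵥ (xv + ω • (S.Tz *ᵥ xu) + S.Tz *ᵥ xf) + S.Bm *ᵥ (ω • u + F)) =
      (S.Cm * S.Am) *ᵥ xv +
        (S.Cm * S.Bbar) *ᵥ (ω • (S.Cz *ᵥ xu + S.Dz *ᵥ u) + (S.Cz *ᵥ xf + S.Dz *ᵥ F)) := by
  rw [hS.plant_field_eq, mulVec_add, mulVec_add, mulVec_smul, hS.Cm_mulVec_Tz, hS.Cm_mulVec_Tz,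
    smul_zero, add_zero, add_zero, mulVec_add, mulVec_mulVec, mulVec_mulVec]

theorem Admissible.H_mul_Cm_mul_Bbar (hS : S.Admissible) : S.H * (S.Cm * S.Bbar) = S.Bbar := by
  rw [H, Matrix.mul_assoc, leftInv_mul_self hS.rank_CmBbar, Matrix.mul_one]

end Design

/-! ### The uncertainty -/

namespace Unknowns.Admissible

variable {n m p nz : ℕ} {S : Design n m p nz} {W : Unknowns n m}

theorem differentiableAt (hW : W.Admissible S) (x : Fin n → ℝ) {t : ℝ} (ht : 0 ≤ t) :
    DifferentiableAt ℝ (fun z => W.f z t) x :=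
  (hW.f_dx (‖x‖ + 1) (by positivity) x (by linarith) t ht).1

theorem norm_sub_le_state (hW : W.Admissible S) {δ : ℝ} {x x' : Fin n → ℝ}
    (hx : ‖x‖ < δ) (hx' : ‖x'‖ < δ) {t : ℝ} (ht : 0 ≤ t) :
    ‖W.f x t - W.f x' t‖ ≤ S.d δ * ‖x - x'‖ := by
  have hδ : 0 < δ := (norm_nonneg _).trans_lt hx
  refine Convex.norm_image_sub_le_of_norm_fderiv_le (𝕜 := ℝ) (f := fun z => W.f z t)
    (s := Metric.ball 0 δ)
    (fun z hz => (hW.f_dx δ hδ z (by simpa using hz) t ht).1)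
    (fun z hz => (hW.f_dx δ hδ z (by simpa using hz) t ht).2) (convex_ball 0 δ)
    (by simpa using hx') (by simpa using hx)

theorem norm_sub_le_time (hW : W.Admissible S) {δ : ℝ} {x : Fin n → ℝ} (hx : ‖x‖ < δ)
    {t t' : ℝ} (ht : 0 ≤ t) (ht' : 0 ≤ t') :
    ‖W.f x t - W.f x t'‖ ≤ S.b δ * |t - t'| := by
  have hδ : 0 < δ := (norm_nonneg _).trans_lt hx
  exact Convex.norm_image_sub_le_of_norm_derivWithin_le
    (fun s hs => (hW.f_dt δ hδ x hx s hs).1) (fun s hs => (hW.f_dt δ hδ x hx s hs).2)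
    (convex_Ici 0) ht' ht

theorem norm_le (hS : S.Admissible) (hW : W.Admissible S) {x : Fin n → ℝ} (hx : ‖x‖ ≤ S.ρx)
    {t : ℝ} (ht : 0 ≤ t) : ‖W.f x t‖ ≤ S.d S.ρx * ‖x‖ + S.b₀ := by
  have hcont : Continuous fun z => W.f z t :=
    continuous_iff_continuousAt.2 fun z => (hW.differentiableAt z ht).continuousAt
  have hclosed : IsClosed {z | ‖W.f z t‖ ≤ S.d S.ρx * ‖z‖ + S.b₀} :=
    isClosed_le hcont.norm ((continuous_const.mul continuous_norm).add continuous_const)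
  have hball : Metric.ball (0 : Fin n → ℝ) S.ρx ⊆ {z | ‖W.f z t‖ ≤ S.d S.ρx * ‖z‖ + S.b₀} := by
    intro z hz
    have hz0 : ‖W.f z t - W.f 0 t‖ ≤ S.d S.ρx * ‖z‖ := by
      simpa only [sub_zero] using
        hW.norm_sub_le_state (x' := 0) (mem_ball_zero_iff.1 hz) (by simpa using hS.ρx_pos) ht
    exact (norm_le_norm_sub_add _ (W.f 0 t)).trans (add_le_add hz0 (hW.f_zero t ht).le)
  refine closure_minimal hball hclosed ?_
  rwa [closure_ball _ hS.ρx_pos.ne', mem_closedBall_zero_iff]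

theorem norm_sub_le (hS : S.Admissible) (hW : W.Admissible S) {δ L : ℝ} {x x' : Fin n → ℝ}
    (hx : ‖x‖ < δ) (hx' : ‖x'‖ < δ) {t t' : ℝ} (ht : 0 ≤ t) (ht' : 0 ≤ t')
    (hL : ‖x - x'‖ ≤ L * |t - t'|) :
    ‖W.f x t - W.f x' t'‖ ≤ (S.d δ * L + S.b δ) * |t - t'| := by
  have hδ : 0 < δ := (norm_nonneg _).trans_lt hx
  calc ‖W.f x t - W.f x' t'‖ ≤ ‖W.f x t - W.f x' t‖ + ‖W.f x' t - W.f x' t'‖ :=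
        norm_sub_le_norm_sub_add_norm_sub _ _ _
    _ ≤ S.d δ * (L * |t - t'|) + S.b δ * |t - t'| := by
        gcongr
        · exact (hW.norm_sub_le_state hx hx' ht).trans
            (mul_le_mul_of_nonneg_left hL (hS.d_pos δ hδ).le)
        · exact hW.norm_sub_le_time hx' ht ht'
    _ = (S.d δ * L + S.b δ) * |t - t'| := by ring

theorem continuousOn_comp (hW : W.Admissible S) {x : ℝ → Fin n → ℝ} {τ : ℝ}
    (hx : ContinuousOn x (Icc 0 τ)) : ContinuousOn (fun t => W.f (x t) t) (Icc 0 τ) := by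
  obtain ⟨C, hC⟩ := isCompact_Icc.exists_bound_of_continuousOn hx
  intro t ht
  have hC' : ∀ s ∈ Icc 0 τ, ‖x s‖ < C + 1 := fun s hs => (hC s hs).trans_lt (by linarith)
  rw [ContinuousWithinAt, tendsto_iff_norm_sub_tendsto_zero]
  refine squeeze_zero' (Filter.Eventually.of_forall fun _ => norm_nonneg _)
    (g := fun s => S.d (C + 1) * ‖x s - x t‖ + S.b (C + 1) * |s - t|) ?_ ?_
  · filter_upwards [self_mem_nhdsWithin] with s hs
    exact (norm_sub_le_norm_sub_add_norm_sub _ (W.f (x t) s) _).trans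
      (add_le_add (hW.norm_sub_le_state (hC' s hs) (hC' t ht) hs.1)
        (hW.norm_sub_le_time (hC' t ht) hs.1 ht.1))
  · have hcont : ContinuousWithinAt
        (fun s => S.d (C + 1) * ‖x s - x t‖ + S.b (C + 1) * |s - t|) (Icc 0 τ) t := by
      have := hx t ht
      fun_prop
    simpa using hcont.tendsto

end Unknowns.Admissible

/-! ### Closed-loop equations and the virtual system -/

namespace Signals

/-- The plant and its input filter, driven by an arbitrary input `u`, on `[0, τ]`. This is the part
of the closed loop on which the lumped uncertainty depends. -/
structure IsPlant {n m p nz nd : ℕ} (s : Signals n m p nz nd) (S : Design n m p nz)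
    (W : Unknowns n m) (τ : ℝ) : Prop where
  x_zero : s.x 0 = W.x₀
  x_ode : ∀ t ∈ Icc 0 τ, HasDerivWithinAt s.x
    (S.Am *ᵥ s.x t + S.Bm *ᵥ (W.ω • s.u t + W.f (s.x t) t)) (Icc 0 τ) t
  xu_zero : s.xu 0 = 0
  xu_ode : ∀ t ∈ Icc 0 τ, HasDerivWithinAt s.xu (S.Az *ᵥ s.xu t + S.Bz *ᵥ s.u t) (Icc 0 τ) t

/-- The predictor and the adaptive laws on `[0, τ]`, with `W` entering only through the measured
initial output. -/
structure IsEstimator {n m p nz mr nd : ℕ} (s : Signals n m p nz nd) (S : Design n m p nz)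
    (W : Unknowns n m) (K : Controller m mr nd) (τ : ℝ) : Prop where
  vHat_zero : s.vHat 0 = 0
  vHat_ode : ∀ t ∈ Icc 0 τ, HasDerivWithinAt s.vHat
    (S.Av *ᵥ s.xvHat S t - S.Kv *ᵥ s.y S t - (S.Pv⁻¹ * S.Amᵀ * S.Cmᵀ * S.Py) *ᵥ s.yTilde S t)
    (Icc 0 τ) t
  yHat_zero : s.yHat 0 = S.Cm *ᵥ W.x₀
  yHat_ode : ∀ t ∈ Icc 0 τ, HasDerivWithinAt s.yHat
    (-(S.α • s.yTilde S t) + (S.Cm * S.Am) *ᵥ s.xvHat S t + (S.Cm * S.Bbar) *ᵥ s.ηHat S t)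
    (Icc 0 τ) t
  ωHat_zero : s.ωHat 0 = 1
  ωHat_ode : ∀ t ∈ Icc 0 τ, HasDerivWithinAt s.ωHat
    (K.Γω * smoothProj K.ε ((S.ωl + S.ωu) / 2) ((S.ωu - S.ωl) / 2) (s.ωHat t)
      (-(s.uz S t ⬝ᵥ s.ey S t))) (Icc 0 τ) t
  θHat_zero : s.θHat 0 = 0
  θHat_ode : ∀ t ∈ Icc 0 τ, HasDerivWithinAt s.θHat
    (K.Γθ • vecProj K.ε (√m * S.dBar) (s.θHat t) (-(‖s.xgHat S t‖ • s.ey S t))) (Icc 0 τ) t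
  σHat_zero : s.σHat 0 = 0
  σHat_ode : ∀ t ∈ Icc 0 τ, HasDerivWithinAt s.σHat
    (K.Γσ • vecProj K.ε (√m * S.bBar) (s.σHat t) (-(s.ey S t))) (Icc 0 τ) t

end Signals

/-- The parameters of the adaptive laws are positive. -/
structure Controller.PosGains {m mr nd : ℕ} (K : Controller m mr nd) : Prop where
  Γω_pos : 0 < K.Γω
  Γθ_pos : 0 < K.Γθ
  Γσ_pos : 0 < K.Γσ
  ε_pos : 0 < K.ε

section Virtual

variable {n m p nz mr nd : ℕ} {S : Design n m p nz} {W : Unknowns n m} {K : Controller m mr nd}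
  {s : Signals n m p nz nd} {τ : ℝ} {xv : ℝ → Fin n → ℝ} {xf : ℝ → Fin nz → ℝ}

theorem Controller.Admissible.posGains (hK : K.Admissible S) : K.PosGains :=
  ⟨hK.Γω_pos, hK.Γθ_pos, hK.Γσ_pos, hK.ε_pos⟩

namespace Signals

theorem IsClosedLoop.isPlant (h : s.IsClosedLoop S W K τ) : s.IsPlant S W τ :=
  ⟨h.x_zero, h.x_ode, h.xu_zero, h.xu_ode⟩

theorem IsClosedLoop.isEstimator (h : s.IsClosedLoop S W K τ) : s.IsEstimator S W K τ :=
  ⟨h.vHat_zero, h.vHat_ode, h.yHat_zero, h.yHat_ode, h.ωHat_zero, h.ωHat_ode, h.θHat_zero,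
    h.θHat_ode, h.σHat_zero, h.σHat_ode⟩

theorem IsClosedLoop.continuousOn_u (h : s.IsClosedLoop S W K τ) : ContinuousOn s.u (Icc 0 τ) :=
  (continuousOn_mulVec continuousOn_const h.xd_cont).neg.congr h.u_eq

theorem IsPlant.continuousOn_x (h : s.IsPlant S W τ) : ContinuousOn s.x (Icc 0 τ) :=
  fun t ht => (h.x_ode t ht).continuousWithinAt

theorem Tg_mulVec_xg (s : Signals n m p nz nd) (S : Design n m p nz) (ω : ℝ)
    (xv : ℝ → Fin n → ℝ) (t : ℝ) :
    S.Tg ω *ᵥ s.xg xv t = xv t + ω • (S.Tz *ᵥ s.xu t) :=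
  S.Tg_mulVec_sumElim ω (xv t) (s.xu t)

end Signals

theorem Unknowns.Admissible.lipschitzOnWith_plant_field (hS : S.Admissible) (hW : W.Admissible S)
    {δ : ℝ} (hδ : 0 < δ) (u : Fin m → ℝ) {t : ℝ} (ht : 0 ≤ t) :
    LipschitzOnWith (infNorm S.Am + infNorm S.Bm * S.d δ).toNNReal
      (fun x => S.Am *ᵥ x + S.Bm *ᵥ (W.ω • u + W.f x t)) (Metric.ball 0 δ) := by
  have hK : 0 ≤ infNorm S.Am + infNorm S.Bm * S.d δ :=
    add_nonneg (infNorm_nonneg _) (mul_nonneg (infNorm_nonneg _) (hS.d_pos δ hδ).le)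
  refine LipschitzOnWith.of_dist_le_mul fun x hx x' hx' => ?_
  rw [dist_eq_norm, dist_eq_norm, Real.coe_toNNReal _ hK]
  have hf := hW.norm_sub_le_state (mem_ball_zero_iff.1 hx) (mem_ball_zero_iff.1 hx') ht
  calc ‖S.Am *ᵥ x + S.Bm *ᵥ (W.ω • u + W.f x t) - (S.Am *ᵥ x' + S.Bm *ᵥ (W.ω • u + W.f x' t))‖
      = ‖S.Am *ᵥ (x - x') + S.Bm *ᵥ (W.f x t - W.f x' t)‖ := by
        simp only [mulVec_add, mulVec_sub]
        congr 1
        abel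
    _ ≤ infNorm S.Am * ‖x - x'‖ + infNorm S.Bm * (S.d δ * ‖x - x'‖) :=
        norm_add_le_of_le (norm_mulVec_le_infNorm _ _)
          (norm_mulVec_le_of_norm_le _ hf)
    _ = (infNorm S.Am + infNorm S.Bm * S.d δ) * ‖x - x'‖ := by ring

theorem Unknowns.Admissible.eqOn_of_plant_ode (hS : S.Admissible) (hW : W.Admissible S)
    {u : ℝ → Fin m → ℝ} {x x' : ℝ → Fin n → ℝ} (h0 : x 0 = x' 0)
    (hx : ∀ t ∈ Icc 0 τ,
      HasDerivWithinAt x (S.Am *ᵥ x t + S.Bm *ᵥ (W.ω • u t + W.f (x t) t)) (Icc 0 τ) t)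
    (hx' : ∀ t ∈ Icc 0 τ,
      HasDerivWithinAt x' (S.Am *ᵥ x' t + S.Bm *ᵥ (W.ω • u t + W.f (x' t) t)) (Icc 0 τ) t) :
    EqOn x x' (Icc 0 τ) := by
  have hxc : ContinuousOn x (Icc 0 τ) := fun t ht => (hx t ht).continuousWithinAt
  have hxc' : ContinuousOn x' (Icc 0 τ) := fun t ht => (hx' t ht).continuousWithinAt
  obtain ⟨C, hC⟩ := isCompact_Icc.exists_bound_of_continuousOn hxc
  obtain ⟨C', hC'⟩ := isCompact_Icc.exists_bound_of_continuousOn hxc'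
  have hδ : 0 < max (max C C') 0 + 1 := by positivity
  refine ODE_solution_unique_of_mem_Icc_right
    (v := fun t x => S.Am *ᵥ x + S.Bm *ᵥ (W.ω • u t + W.f x t))
    (s := fun _ => Metric.ball 0 (max (max C C') 0 + 1))
    (fun t ht => hW.lipschitzOnWith_plant_field hS hδ (u t) ht.1)
    hxc (fun t ht => hasDerivWithinAt_Ici_of_Icc ht (hx t (Ico_subset_Icc_self ht)))
    (fun t ht => ?_)
    hxc' (fun t ht => hasDerivWithinAt_Ici_of_Icc ht (hx' t (Ico_subset_Icc_self ht)))
    (fun t ht => ?_) h0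
  · have := hC t (Ico_subset_Icc_self ht)
    exact mem_ball_zero_iff.2 (by grind)
  · have := hC' t (Ico_subset_Icc_self ht)
    exact mem_ball_zero_iff.2 (by grind)

namespace Signals

theorem IsVirtual.hasDerivWithinAt_state (hS : S.Admissible) (h : s.IsPlant S W τ)
    (hv : s.IsVirtual S W τ xv xf) {t : ℝ} (ht : t ∈ Icc 0 τ) :
    HasDerivWithinAt (fun r => S.Tg W.ω *ᵥ s.xg xv r + S.Tz *ᵥ xf r)
      (S.Am *ᵥ (S.Tg W.ω *ᵥ s.xg xv t + S.Tz *ᵥ xf t) +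
        S.Bm *ᵥ (W.ω • s.u t + s.fv S W xv xf t)) (Icc 0 τ) t := by
  have hsum := ((hv.xv_ode t ht).fun_add ((hasDerivWithinAt_const_mulVec S.Tz
    (h.xu_ode t ht)).fun_const_smul W.ω)).fun_add
    (hasDerivWithinAt_const_mulVec S.Tz (hv.xf_ode t ht))
  simp only [Tg_mulVec_xg]
  exact hsum.congr_deriv (hS.plant_field_eq W.ω (xv t) (s.xu t) (xf t) (s.u t) _).symm

/-- Both sides solve the plant equation with the same initial value. -/
theorem IsVirtual.state_eq (hS : S.Admissible) (hW : W.Admissible S)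
    (h : s.IsPlant S W τ) (hv : s.IsVirtual S W τ xv xf) {t : ℝ} (ht : t ∈ Icc 0 τ) :
    S.Tg W.ω *ᵥ s.xg xv t + S.Tz *ᵥ xf t = s.x t := by
  refine hW.eqOn_of_plant_ode hS ?_ (fun r hr => hv.hasDerivWithinAt_state hS h hr) h.x_ode ht
  simp only [Tg_mulVec_xg, hv.xv_zero, hv.xf_zero, h.xu_zero, h.x_zero, mulVec_zero, smul_zero,
    add_zero]

theorem IsVirtual.xv_eq (hS : S.Admissible) (hW : W.Admissible S) (h : s.IsPlant S W τ)
    (hv : s.IsVirtual S W τ xv xf) {t : ℝ} (ht : t ∈ Icc 0 τ) :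
    xv t = s.x t - W.ω • (S.Tz *ᵥ s.xu t) - S.Tz *ᵥ xf t := by
  rw [← hv.state_eq hS hW h ht, Tg_mulVec_xg]
  abel

theorem IsVirtual.fv_eq (hS : S.Admissible) (hW : W.Admissible S) (h : s.IsPlant S W τ)
    (hv : s.IsVirtual S W τ xv xf) {t : ℝ} (ht : t ∈ Icc 0 τ) :
    s.fv S W xv xf t = W.f (s.x t) t := by
  rw [fv, hv.state_eq hS hW h ht]

theorem IsVirtual.fBar_eq (hS : S.Admissible) (hW : W.Admissible S) (h : s.IsPlant S W τ)
    (hv : s.IsVirtual S W τ xv xf) {t : ℝ} (ht : t ∈ Icc 0 τ) :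
    s.fBar S W xv xf t = S.Cz *ᵥ xf t + S.Dz *ᵥ W.f (s.x t) t := by
  rw [fBar, hv.fv_eq hS hW h ht]

/-- Drive the filter by the uncertainty along the plant and let `xv` be what is left of `x`. -/
theorem IsPlant.exists_isVirtual (hS : S.Admissible) (hW : W.Admissible S)
    (hτ : 0 ≤ τ) (h : s.IsPlant S W τ) : ∃ xv xf, s.IsVirtual S W τ xv xf := by
  obtain ⟨xf, hxf0, hxf⟩ := exists_linear_ode_solution S.Az S.Bz hτ
    (hW.continuousOn_comp h.continuousOn_x)
  set xv : ℝ → Fin n → ℝ := fun t => s.x t - W.ω • (S.Tz *ᵥ s.xu t) - S.Tz *ᵥ xf t with hxv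
  have hstate : ∀ t, xv t + W.ω • (S.Tz *ᵥ s.xu t) + S.Tz *ᵥ xf t = s.x t := fun t => by
    simp only [hxv]; abel
  have hfv : ∀ t, s.fv S W xv xf t = W.f (s.x t) t := fun t => by
    rw [fv, Tg_mulVec_xg, hstate]
  refine ⟨xv, xf, hxf0, fun t ht => by rw [hfv]; exact hxf t ht, ?_, fun t ht => ?_⟩
  · simp only [hxv, h.x_zero, h.xu_zero, hxf0, mulVec_zero, smul_zero, sub_zero]
  · refine (((h.x_ode t ht).fun_sub ((hasDerivWithinAt_const_mulVec S.Tz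
      (h.xu_ode t ht)).fun_const_smul W.ω)).fun_sub
      (hasDerivWithinAt_const_mulVec S.Tz (hxf t ht))).congr_deriv ?_
    have hfield := hS.plant_field_eq W.ω (xv t) (s.xu t) (xf t) (s.u t) (W.f (s.x t) t)
    rw [hstate] at hfield
    rw [hfield, fBar, hfv, uz]
    abel

end Signals

end Virtual

/-! ### Rate bounds -/

section Parametrization

variable {E : Type*} [NormedAddCommGroup E] [NormedSpace ℝ E]

theorem norm_div_smul_sub_div_smul_le {a a' : E} {D D' β γ M₁ M₂ r : ℝ} (hγ : 0 ≤ γ) (hβ : 0 < β)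
    (hD : β ≤ D) (hD' : 0 < D') (ha' : ‖a'‖ ≤ D') (haa' : ‖a - a'‖ ≤ M₁ * r)
    (hDD' : |D - D'| ≤ M₂ * r) :
    ‖(γ / D) • a - (γ / D') • a'‖ ≤ γ * ((M₁ + M₂) / β) * r := by
  have hD0 : 0 < D := hβ.trans_le hD
  have hsplit : (γ / D) • a - (γ / D') • a' = (γ / D) • ((a - a') - ((D - D') / D') • a') := by
    rw [smul_sub (γ / D) (a - a'), smul_sub (γ / D) a, smul_smul, sub_sub, ← add_smul]
    congr 2
    field_simp
    ring
  have hratio : ‖((D - D') / D') • a'‖ ≤ M₂ * r := by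
    rw [norm_smul, Real.norm_eq_abs, abs_div, abs_of_pos hD', div_mul_eq_mul_div, div_le_iff₀ hD']
    exact mul_le_mul hDD' ha' (norm_nonneg _) ((abs_nonneg _).trans hDD')
  calc ‖(γ / D) • a - (γ / D') • a'‖
      = γ / D * ‖(a - a') - ((D - D') / D') • a'‖ := by
        rw [hsplit, norm_smul, Real.norm_of_nonneg (div_nonneg hγ hD0.le)]
    _ ≤ γ / β * (M₁ * r + M₂ * r) := by
        gcongr
        exact norm_sub_le_of_le haa' hratio
    _ = γ * ((M₁ + M₂) / β) * r := by ring

/-- Split `g` in the proportion of the two terms of its bound: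
`θ = d g / (d ρ + b)` and `σ = b g / (d ρ + b)`. -/
theorem exists_affine_parametrization {I : Set ℝ} {g : ℝ → E} {ρ : ℝ → ℝ} {d b M₁ M₂ : ℝ}
    (hd : 0 ≤ d) (hb : 0 < b) (hρ : ∀ t ∈ I, 0 ≤ ρ t) (hg : ∀ t ∈ I, ‖g t‖ ≤ d * ρ t + b)
    (hgLip : ∀ t ∈ I, ∀ t' ∈ I, ‖g t - g t'‖ ≤ M₁ * |t - t'|)
    (hρLip : ∀ t ∈ I, ∀ t' ∈ I, |ρ t - ρ t'| ≤ M₂ * |t - t'|) :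
    ∃ θ σ : ℝ → E, (∀ t ∈ I, g t = ρ t • θ t + σ t) ∧
      (∀ t ∈ I, ‖θ t‖ ≤ d ∧ ‖σ t‖ ≤ b) ∧
      ∀ t ∈ I, ∀ t' ∈ I, ‖θ t - θ t'‖ ≤ d * ((M₁ + d * M₂) / b) * |t - t'| ∧
        ‖σ t - σ t'‖ ≤ b * ((M₁ + d * M₂) / b) * |t - t'| := by
  set D : ℝ → ℝ := fun t => d * ρ t + b with hD
  have hbD : ∀ t ∈ I, b ≤ D t := fun t ht => le_add_of_nonneg_left (mul_nonneg hd (hρ t ht))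
  have hD0 : ∀ t ∈ I, 0 < D t := fun t ht => hb.trans_le (hbD t ht)
  have hDLip : ∀ t ∈ I, ∀ t' ∈ I, |D t - D t'| ≤ d * M₂ * |t - t'| := fun t ht t' ht' => by
    rw [hD, add_sub_add_right_eq_sub, ← mul_sub, abs_mul, abs_of_nonneg hd, mul_assoc]
    exact mul_le_mul_of_nonneg_left (hρLip t ht t' ht') hd
  have hbound : ∀ γ, 0 ≤ γ → ∀ t ∈ I, ‖(γ / D t) • g t‖ ≤ γ := fun γ hγ t ht => by
    rw [norm_smul, Real.norm_of_nonneg (div_nonneg hγ (hD0 t ht).le), div_mul_eq_mul_div,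
      div_le_iff₀ (hD0 t ht)]
    exact mul_le_mul_of_nonneg_left (hg t ht) hγ
  have hLip : ∀ γ, 0 ≤ γ → ∀ t ∈ I, ∀ t' ∈ I, ‖(γ / D t) • g t - (γ / D t') • g t'‖ ≤
      γ * ((M₁ + d * M₂) / b) * |t - t'| := fun γ hγ t ht t' ht' =>
    norm_div_smul_sub_div_smul_le hγ hb (hbD t ht) (hD0 t' ht') (hg t' ht')
      (hgLip t ht t' ht') (hDLip t ht t' ht')
  refine ⟨fun t => (d / D t) • g t, fun t => (b / D t) • g t, fun t ht => ?_,
    fun t ht => ⟨hbound d hd t ht, hbound b hb.le t ht⟩,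
    fun t ht t' ht' => ⟨hLip d hd t ht t' ht', hLip b hb.le t ht t' ht'⟩⟩
  have hone : ρ t * (d / D t) + b / D t = 1 := by
    rw [mul_div_assoc', ← add_div, mul_comm, div_self (hD0 t ht).ne']
  rw [smul_smul, ← add_smul, hone, one_smul]

end Parametrization

theorem norm_sumElim_sub_sumElim_le {ι κ : Type*} [Fintype ι] [Fintype κ] (v v' : ι → ℝ)
    (w w' : κ → ℝ) : ‖Sum.elim v w - Sum.elim v' w'‖ ≤ ‖v - v'‖ + ‖w - w'‖ := by
  refine (pi_norm_le_iff_of_nonneg (by positivity)).2 fun i => ?_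
  rcases i with i | i
  · exact (norm_le_pi_norm (v - v') i).trans (le_add_of_nonneg_right (norm_nonneg _))
  · exact (norm_le_pi_norm (w - w') i).trans (le_add_of_nonneg_left (norm_nonneg _))

namespace Design

variable {n m p nz : ℕ} {S : Design n m p nz}

/-- Bound on the uncertainty along the plant. -/
noncomputable def fMax (S : Design n m p nz) : ℝ := S.d S.ρx * S.ρx + S.b₀

/-- Bound on the rate of change of the plant state. -/
noncomputable def xRate (S : Design n m p nz) : ℝ :=
  infNorm S.Am * S.ρx + infNorm S.Bm * (S.ωu * S.ρu + S.fMax)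

/-- Bound on the rate of change of the state of the filter `(Az, Bz)` with input bound `ρ`. -/
noncomputable def filterRate (S : Design n m p nz) (ρ : ℝ) : ℝ :=
  infNorm S.Az * (l1Norm S.Az S.Bz (1 : Matrix (Fin nz) (Fin nz) ℝ) * ρ) + infNorm S.Bz * ρ

/-- Bound on the rate of change of the lumped uncertainty. The derivative bounds on `f` hold on
open balls, hence the radius `ρx + 1`. -/
noncomputable def fBarRate (S : Design n m p nz) : ℝ :=
  infNorm S.Cz * S.filterRate S.fMax +
    infNorm S.Dz * (S.d (S.ρx + 1) * S.xRate + S.b (S.ρx + 1))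

/-- Bound on the rate of change of the state `x_g` of the virtual system. -/
noncomputable def xgRate (S : Design n m p nz) : ℝ :=
  S.xRate + S.ωu * (infNorm S.Tz * S.filterRate S.ρu) + infNorm S.Tz * S.filterRate S.fMax +
    S.filterRate S.ρu

/-- The relative rate of change, common to both parameters of the lumped uncertainty. -/
noncomputable def paramRate (S : Design n m p nz) : ℝ := (S.fBarRate + S.dBar * S.xgRate) / S.bBar

theorem Admissible.ωu_pos (hS : S.Admissible) : 0 < S.ωu := hS.ωl_pos.trans hS.ωl_lt

theorem Admissible.fMax_nonneg (hS : S.Admissible) : 0 ≤ S.fMax :=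
  (add_pos (mul_pos hS.d_ρx_pos hS.ρx_pos) hS.b₀_pos).le

theorem filterRate_nonneg (S : Design n m p nz) {ρ : ℝ} (hρ : 0 ≤ ρ) : 0 ≤ S.filterRate ρ :=
  add_nonneg (mul_nonneg (infNorm_nonneg _) (mul_nonneg (l1Norm_nonneg _ _ _) hρ))
    (mul_nonneg (infNorm_nonneg _) hρ)

theorem Admissible.xRate_nonneg (hS : S.Admissible) : 0 ≤ S.xRate := by
  rw [xRate]
  positivity [infNorm_nonneg S.Am, infNorm_nonneg S.Bm, hS.ρx_pos, hS.ρu_pos, hS.ωu_pos,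
    hS.fMax_nonneg]

theorem Admissible.fBarRate_nonneg (hS : S.Admissible) : 0 ≤ S.fBarRate := by
  have hρ : 0 < S.ρx + 1 := by linarith [hS.ρx_pos]
  rw [fBarRate]
  positivity [infNorm_nonneg S.Cz, infNorm_nonneg S.Dz, S.filterRate_nonneg hS.fMax_nonneg,
    hS.d_pos _ hρ, hS.b_pos _ hρ, hS.xRate_nonneg]

theorem Admissible.xgRate_nonneg (hS : S.Admissible) : 0 ≤ S.xgRate := by
  rw [xgRate]
  positivity [infNorm_nonneg S.Tz, S.filterRate_nonneg hS.fMax_nonneg,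
    S.filterRate_nonneg hS.ρu_pos.le, hS.xRate_nonneg, hS.ωu_pos]

theorem Admissible.paramRate_nonneg (hS : S.Admissible) : 0 ≤ S.paramRate :=
  div_nonneg (add_nonneg hS.fBarRate_nonneg (mul_nonneg hS.dBar_nonneg hS.xgRate_nonneg))
    hS.bBar_nonneg

theorem Admissible.norm_filter_sub_le (hS : S.Admissible) {z : ℝ → Fin nz → ℝ}
    {w : ℝ → Fin m → ℝ} {τ ρ : ℝ} (hz0 : z 0 = 0)
    (hz : ∀ t ∈ Icc 0 τ, HasDerivWithinAt z (S.Az *ᵥ z t + S.Bz *ᵥ w t) (Icc 0 τ) t)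
    (hw : ContinuousOn w (Icc 0 τ)) (hρ : ∀ t ∈ Icc 0 τ, ‖w t‖ ≤ ρ) {t t' : ℝ}
    (ht : t ∈ Icc 0 τ) (ht' : t' ∈ Icc 0 τ) : ‖z t - z t'‖ ≤ S.filterRate ρ * |t - t'| := by
  refine Convex.norm_image_sub_le_of_norm_hasDerivWithin_le hz (fun r hr => ?_)
    (convex_Icc 0 τ) ht' ht
  have hzr := hS.Az_hurwitz.norm_mulVec_le_l1Norm_mul
    (C := (1 : Matrix (Fin nz) (Fin nz) ℝ)) hz0 hz hw hρ hr
  rw [one_mulVec] at hzr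
  exact norm_add_le_of_le (norm_mulVec_le_of_norm_le _ hzr) (norm_mulVec_le_of_norm_le _ (hρ r hr))

end Design

namespace Signals

variable {n m p nz nd : ℕ} {S : Design n m p nz} {W : Unknowns n m} {s : Signals n m p nz nd}
  {τ t t' : ℝ} {xv : ℝ → Fin n → ℝ} {xf : ℝ → Fin nz → ℝ}

theorem Bounded.norm_f_le (hS : S.Admissible) (hW : W.Admissible S) (hb : s.Bounded S τ)
    (ht : t ∈ Icc 0 τ) : ‖W.f (s.x t) t‖ ≤ S.fMax :=
  (hW.norm_le hS (hb t ht).1 ht.1).trans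
    (add_le_add_left (mul_le_mul_of_nonneg_left (hb t ht).1 hS.d_ρx_pos.le) _)

theorem IsPlant.norm_x_sub_le (hS : S.Admissible) (hW : W.Admissible S) (h : s.IsPlant S W τ)
    (hb : s.Bounded S τ) (ht : t ∈ Icc 0 τ) (ht' : t' ∈ Icc 0 τ) :
    ‖s.x t - s.x t'‖ ≤ S.xRate * |t - t'| := by
  refine Convex.norm_image_sub_le_of_norm_hasDerivWithin_le h.x_ode (fun r hr => ?_)
    (convex_Icc 0 τ) ht' ht
  have hωu : ‖W.ω • s.u r‖ ≤ S.ωu * S.ρu := by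
    rw [norm_smul, Real.norm_of_nonneg (hS.ωl_pos.le.trans hW.ω_mem.1)]
    exact mul_le_mul hW.ω_mem.2 (hb r hr).2 (norm_nonneg _) hS.ωu_pos.le
  exact norm_add_le_of_le (norm_mulVec_le_of_norm_le _ (hb r hr).1)
    (norm_mulVec_le_of_norm_le _ (norm_add_le_of_le hωu (hb.norm_f_le hS hW hr)))

theorem IsPlant.norm_xu_sub_le (hS : S.Admissible) (h : s.IsPlant S W τ)
    (hu : ContinuousOn s.u (Icc 0 τ)) (hb : s.Bounded S τ) (ht : t ∈ Icc 0 τ)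
    (ht' : t' ∈ Icc 0 τ) : ‖s.xu t - s.xu t'‖ ≤ S.filterRate S.ρu * |t - t'| :=
  hS.norm_filter_sub_le h.xu_zero h.xu_ode hu (fun r hr => (hb r hr).2) ht ht'

section Virtual

variable (hS : S.Admissible) (hW : W.Admissible S) (h : s.IsPlant S W τ) (hb : s.Bounded S τ)
  (hv : s.IsVirtual S W τ xv xf)

include hS hW h hv

theorem IsVirtual.hasDerivWithinAt_xf (ht : t ∈ Icc 0 τ) :
    HasDerivWithinAt xf (S.Az *ᵥ xf t + S.Bz *ᵥ W.f (s.x t) t) (Icc 0 τ) t := by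
  rw [← hv.fv_eq hS hW h ht]
  exact hv.xf_ode t ht

include hb

theorem IsVirtual.norm_xf_sub_le (ht : t ∈ Icc 0 τ) (ht' : t' ∈ Icc 0 τ) :
    ‖xf t - xf t'‖ ≤ S.filterRate S.fMax * |t - t'| :=
  hS.norm_filter_sub_le hv.xf_zero (fun _ => hv.hasDerivWithinAt_xf hS hW h)
    (hW.continuousOn_comp h.continuousOn_x) (fun _ => hb.norm_f_le hS hW) ht ht'

theorem IsVirtual.norm_Tz_mulVec_xf_le (ht : t ∈ Icc 0 τ) :
    ‖S.Tz *ᵥ xf t‖ ≤ l1Norm S.Az S.Bz S.Tz * S.fMax :=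
  hS.Az_hurwitz.norm_mulVec_le_l1Norm_mul hv.xf_zero
    (fun _ => hv.hasDerivWithinAt_xf hS hW h) (hW.continuousOn_comp h.continuousOn_x)
    (fun _ => hb.norm_f_le hS hW) ht

theorem IsVirtual.norm_Cz_mulVec_xf_le (ht : t ∈ Icc 0 τ) :
    ‖S.Cz *ᵥ xf t‖ ≤ infNorm (S.Cz * leftInv S.Tz) * S.ρx +
      infNorm (S.Cz * leftInv S.Tz * S.Tg W.ω) * ‖s.xg xv t‖ := by
  have hCz : S.Cz *ᵥ xf t =
      (S.Cz * leftInv S.Tz) *ᵥ s.x t - (S.Cz * leftInv S.Tz * S.Tg W.ω) *ᵥ s.xg xv t := by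
    rw [← hv.state_eq hS hW h ht, mulVec_add, mulVec_mulVec, mulVec_mulVec, add_sub_cancel_left,
      Matrix.mul_assoc, leftInv_mul_self hS.rank_Tz, Matrix.mul_one]
  rw [hCz]
  exact norm_sub_le_of_le (norm_mulVec_le_of_norm_le _ (hb t ht).1) (norm_mulVec_le_infNorm _ _)

theorem IsVirtual.norm_fBar_le (ht : t ∈ Icc 0 τ) :
    ‖s.fBar S W xv xf t‖ ≤ S.dBar * ‖s.xg xv t‖ + S.bBar := by
  have hx : ‖s.x t‖ ≤ infNorm (S.Tg W.ω) * ‖s.xg xv t‖ + l1Norm S.Az S.Bz S.Tz * S.fMax := by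
    rw [← hv.state_eq hS hW h ht]
    exact norm_add_le_of_le (norm_mulVec_le_infNorm _ _)
      (hv.norm_Tz_mulVec_xf_le hS hW h hb ht)
  have hf : ‖W.f (s.x t) t‖ ≤ S.d S.ρx *
      (infNorm (S.Tg W.ω) * ‖s.xg xv t‖ + l1Norm S.Az S.Bz S.Tz * S.fMax) + S.b₀ :=
    (hW.norm_le hS (hb t ht).1 ht.1).trans
      (add_le_add_left (mul_le_mul_of_nonneg_left hx hS.d_ρx_pos.le) _)
  have hdBar := mul_le_mul_of_nonneg_right (S.le_dBar hW.ω_mem) (norm_nonneg (s.xg xv t))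
  rw [hv.fBar_eq hS hW h ht]
  refine (norm_add_le_of_le (hv.norm_Cz_mulVec_xf_le hS hW h hb ht)
    (norm_mulVec_le_of_norm_le _ hf)).trans ?_
  rw [Design.bBar, Design.fMax]
  linarith

theorem IsVirtual.norm_fBar_sub_le (ht : t ∈ Icc 0 τ) (ht' : t' ∈ Icc 0 τ) :
    ‖s.fBar S W xv xf t - s.fBar S W xv xf t'‖ ≤ S.fBarRate * |t - t'| := by
  have hball : ∀ r ∈ Icc 0 τ, ‖s.x r‖ < S.ρx + 1 := fun r hr =>
    (hb r hr).1.trans_lt (lt_add_one _)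
  rw [hv.fBar_eq hS hW h ht, hv.fBar_eq hS hW h ht', add_sub_add_comm, ← mulVec_sub, ← mulVec_sub]
  refine (norm_add_le_of_le
    (norm_mulVec_le_of_norm_le _ (hv.norm_xf_sub_le hS hW h hb ht ht'))
    (norm_mulVec_le_of_norm_le _ (hW.norm_sub_le hS (hball t ht) (hball t' ht') ht.1 ht'.1
      (h.norm_x_sub_le hS hW hb ht ht')))).trans_eq ?_
  rw [Design.fBarRate]
  ring

theorem IsVirtual.norm_xg_sub_le (hu : ContinuousOn s.u (Icc 0 τ)) (ht : t ∈ Icc 0 τ)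
    (ht' : t' ∈ Icc 0 τ) : ‖s.xg xv t - s.xg xv t'‖ ≤ S.xgRate * |t - t'| := by
  have hxu := h.norm_xu_sub_le hS hu hb ht ht'
  have hsplit : xv t - xv t' = (s.x t - s.x t') - W.ω • (S.Tz *ᵥ (s.xu t - s.xu t')) -
      S.Tz *ᵥ (xf t - xf t') := by
    rw [hv.xv_eq hS hW h ht, hv.xv_eq hS hW h ht', mulVec_sub, mulVec_sub, smul_sub]
    abel
  have hω : ‖W.ω • (S.Tz *ᵥ (s.xu t - s.xu t'))‖ ≤
      S.ωu * (infNorm S.Tz * (S.filterRate S.ρu * |t - t'|)) := by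
    rw [norm_smul, Real.norm_of_nonneg (hS.ωl_pos.le.trans hW.ω_mem.1)]
    exact mul_le_mul hW.ω_mem.2 (norm_mulVec_le_of_norm_le _ hxu) (norm_nonneg _) hS.ωu_pos.le
  have hxv : ‖xv t - xv t'‖ ≤ S.xRate * |t - t'| +
      S.ωu * (infNorm S.Tz * (S.filterRate S.ρu * |t - t'|)) +
      infNorm S.Tz * (S.filterRate S.fMax * |t - t'|) := by
    rw [hsplit]
    exact norm_sub_le_of_le (norm_sub_le_of_le (h.norm_x_sub_le hS hW hb ht ht') hω)
      (norm_mulVec_le_of_norm_le _ (hv.norm_xf_sub_le hS hW h hb ht ht'))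
  calc ‖s.xg xv t - s.xg xv t'‖ ≤ ‖xv t - xv t'‖ + ‖s.xu t - s.xu t'‖ :=
        norm_sumElim_sub_sumElim_le _ _ _ _
    _ ≤ S.xgRate * |t - t'| := by
        rw [Design.xgRate]
        linarith

end Virtual

theorem IsPlant.parametrized (hS : S.Admissible) (hW : W.Admissible S) (hτ : 0 ≤ τ)
    (h : s.IsPlant S W τ) (hu : ContinuousOn s.u (Icc 0 τ)) (hb : s.Bounded S τ) :
    s.Parametrized S W τ (S.dBar * S.paramRate) (S.bBar * S.paramRate) := by
  obtain ⟨xv, xf, hv⟩ := h.exists_isVirtual hS hW hτ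
  rcases Nat.eq_zero_or_pos m with rfl | hm
  · have hrate := hS.paramRate_nonneg
    have hd := hS.dBar_nonneg
    have hb := hS.bBar_nonneg
    refine ⟨xv, xf, 0, 0, hv, fun _ _ => Subsingleton.elim _ _, fun _ _ => ?_, fun _ _ _ _ => ?_⟩
    · simpa only [Pi.zero_apply, norm_zero] using ⟨hd, hb⟩
    · simp only [Pi.zero_apply, sub_self, norm_zero]
      constructor <;> positivity
  · obtain ⟨θ, σ, hθσ⟩ := exists_affine_parametrization hS.dBar_nonneg (hS.bBar_pos hm)
      (fun t _ => norm_nonneg (s.xg xv t)) (fun _ => hv.norm_fBar_le hS hW h hb)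
      (fun _ ht _ ht' => hv.norm_fBar_sub_le hS hW h hb ht ht')
      (fun _ ht _ ht' => (abs_norm_sub_norm_le _ _).trans (hv.norm_xg_sub_le hS hW h hb hu ht ht'))
    exact ⟨xv, xf, θ, σ, hv, hθσ⟩

end Signals

/-! ### Energy of the estimation errors -/

section DotProduct

variable {ι κ : Type*} [Fintype ι] [Fintype κ]

theorem dotProduct_sq_le (v w : ι → ℝ) : (v ⬝ᵥ w) ^ 2 ≤ (v ⬝ᵥ v) * (w ⬝ᵥ w) := by
  simp only [sq, dotProduct_eq_inner_toLp]
  exact real_inner_mul_inner_self_le _ _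

theorem dotProduct_transpose_mul_mulVec (A : Matrix κ ι ℝ) (v w : ι → ℝ) :
    v ⬝ᵥ ((Aᵀ * A) *ᵥ w) = (A *ᵥ v) ⬝ᵥ (A *ᵥ w) := by
  rw [← mulVec_mulVec, dotProduct_transpose_mulVec, dotProduct_comm]

theorem dotProduct_mulVec_comm {P : Matrix ι ι ℝ} (hP : Pᵀ = P) (v w : ι → ℝ) :
    v ⬝ᵥ (P *ᵥ w) = w ⬝ᵥ (P *ᵥ v) := by
  rw [← dotProduct_transpose_mulVec, hP]

theorem dotProduct_mulVec_mulVec_of_transpose_eq {P : Matrix ι ι ℝ} (hP : Pᵀ = P)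
    (A : Matrix ι κ ℝ) (v : ι → ℝ) (w : κ → ℝ) :
    v ⬝ᵥ (P *ᵥ (A *ᵥ w)) = w ⬝ᵥ ((Aᵀ * P) *ᵥ v) := by
  rw [dotProduct_mulVec_comm hP, dotProduct_comm, ← mulVec_mulVec, dotProduct_transpose_mulVec,
    dotProduct_comm]

theorem dotProduct_mulVec_self_nonneg {P : Matrix ι ι ℝ} (hP : P.PosSemidef) (v : ι → ℝ) :
    0 ≤ v ⬝ᵥ (P *ᵥ v) := by
  simpa only [star_trivial] using hP.dotProduct_mulVec_nonneg v

end DotProduct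

namespace Design

variable {n m p nz : ℕ} {S : Design n m p nz}

theorem Admissible.lambdaMin_Qv_pos (hS : S.Admissible) : 0 < lambdaMin S.Qv :=
  lambdaMin_sub_smul_one_pos hS.n_pos hS.Q_pos.isHermitian hS.εq_lt

theorem Admissible.lam₁_pos (hS : S.Admissible) : 0 < S.lam₁ :=
  lt_min (div_pos hS.lambdaMin_Qv_pos (lambdaMax_pos hS.n_pos hS.Pv_pos)) hS.αy_pos

theorem Admissible.transpose_Pv (hS : S.Admissible) : S.Pvᵀ = S.Pv :=
  (conjTranspose_eq_transpose_of_trivial _).symm.trans hS.Pv_pos.isHermitian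

theorem Admissible.transpose_Py (hS : S.Admissible) : S.Pyᵀ = S.Py :=
  (conjTranspose_eq_transpose_of_trivial _).symm.trans hS.Py_pos.isHermitian

theorem Admissible.posSemidef_PvBar (hS : S.Admissible) : S.PvBar.PosSemidef := by
  simpa only [PvBar, conjTranspose_eq_transpose_of_trivial] using
    hS.Pv_pos.posSemidef.conjTranspose_mul_mul_same (1 - S.H * S.Cm)

theorem Admissible.lam₁_mul_dotProduct_Pv_le (hS : S.Admissible) (e : Fin n → ℝ) :
    S.lam₁ * (e ⬝ᵥ (S.Pv *ᵥ e)) ≤ e ⬝ᵥ (S.Qv *ᵥ e) := by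
  have hmax := lambdaMax_pos hS.n_pos hS.Pv_pos
  have hQv : S.Qv.IsHermitian :=
    hS.Q_pos.isHermitian.sub (isHermitian_one.smul (IsSelfAdjoint.all S.εq))
  calc S.lam₁ * (e ⬝ᵥ (S.Pv *ᵥ e)) ≤ S.lam₁ * (lambdaMax S.Pv * (e ⬝ᵥ e)) :=
        mul_le_mul_of_nonneg_left (dotProduct_le_lambdaMax_mul hS.Pv_pos.isHermitian e)
          hS.lam₁_pos.le
    _ ≤ lambdaMin S.Qv / lambdaMax S.Pv * (lambdaMax S.Pv * (e ⬝ᵥ e)) :=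
        mul_le_mul_of_nonneg_right (min_le_left _ _)
          (mul_nonneg hmax.le (dotProduct_self_nonneg e))
    _ = lambdaMin S.Qv * (e ⬝ᵥ e) := by field_simp
    _ ≤ e ⬝ᵥ (S.Qv *ᵥ e) := lambdaMin_mul_dotProduct_le hQv e

theorem Admissible.lam₁_mul_dotProduct_Py_le (hS : S.Admissible) (yt : Fin p → ℝ) :
    S.lam₁ * (yt ⬝ᵥ (S.Py *ᵥ yt)) ≤ (2 * S.α - S.αφ) * (yt ⬝ᵥ (S.Py *ᵥ yt)) :=
  mul_le_mul_of_nonneg_right (min_le_right _ _)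
    (dotProduct_mulVec_self_nonneg hS.Py_pos.posSemidef yt)

theorem Admissible.two_mul_dotProduct_Pv_mulVec_Av (hS : S.Admissible) (e : Fin n → ℝ) :
    2 * (e ⬝ᵥ (S.Pv *ᵥ (S.Av *ᵥ e))) = -(e ⬝ᵥ (S.Qv *ᵥ e)) - S.εq * (e ⬝ᵥ e) := by
  have hlyap := congrArg (fun M => e ⬝ᵥ (M *ᵥ e)) hS.lyapunov
  simp only [add_mulVec, dotProduct_add, neg_mulVec, dotProduct_neg,
    ← dotProduct_mulVec_mulVec_of_transpose_eq hS.transpose_Pv] at hlyap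
  rw [← mulVec_mulVec] at hlyap
  rw [Qv, sub_mulVec, dotProduct_sub, smul_mulVec, one_mulVec, dotProduct_smul, smul_eq_mul]
  linarith

theorem Admissible.dotProduct_Pv_mulVec_coupling (hS : S.Admissible) (e : Fin n → ℝ)
    (yt : Fin p → ℝ) :
    e ⬝ᵥ (S.Pv *ᵥ ((S.Pv⁻¹ * S.Amᵀ * S.Cmᵀ * S.Py) *ᵥ yt)) =
      yt ⬝ᵥ (S.Py *ᵥ ((S.Cm * S.Am) *ᵥ e)) := by
  have hPv : S.Pv * S.Pv⁻¹ = 1 := mul_nonsing_inv _ hS.Pv_pos.det_pos.ne'.isUnit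
  rw [dotProduct_mulVec_mulVec_of_transpose_eq hS.transpose_Py, mulVec_mulVec, transpose_mul]
  simp only [← Matrix.mul_assoc, hPv, Matrix.one_mul]

theorem Admissible.dotProduct_Py_mulVec_Cm_mul_Bbar (hS : S.Admissible) (yt : Fin p → ℝ)
    (w : Fin m → ℝ) : yt ⬝ᵥ (S.Py *ᵥ ((S.Cm * S.Bbar) *ᵥ w)) =
      w ⬝ᵥ ((S.Bbarᵀ * S.Cmᵀ * S.Py) *ᵥ yt) := by
  rw [dotProduct_mulVec_mulVec_of_transpose_eq hS.transpose_Py, transpose_mul]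

theorem Admissible.dotProduct_Py_mulVec_sq_le (hS : S.Admissible) (yt : Fin p → ℝ)
    {θ : Fin m → ℝ} (hθ : ‖θ‖ ≤ S.dBar) :
    (yt ⬝ᵥ (S.Py *ᵥ ((S.Cm * S.Bbar) *ᵥ θ))) ^ 2 ≤ S.εq * S.αφ * (yt ⬝ᵥ (S.Py *ᵥ yt)) := by
  have hθ_sq : θ ⬝ᵥ θ ≤ m * S.dBar ^ 2 := by
    refine (dotProduct_self_le_card_mul_norm_sq θ).trans ?_
    rw [Fintype.card_fin]
    gcongr
  rw [← hS.sqrtPy_sq, dotProduct_transpose_mul_mulVec, dotProduct_transpose_mul_mulVec,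
    mulVec_mulVec, ← Matrix.mul_assoc]
  have hnonneg := dotProduct_self_nonneg (S.sqrtPy *ᵥ yt)
  calc _ ≤ _ := dotProduct_sq_le _ _
    _ ≤ (S.sqrtPy *ᵥ yt) ⬝ᵥ (S.sqrtPy *ᵥ yt) *
          (twoNorm (S.sqrtPy * S.Cm * S.Bbar) ^ 2 * (m * S.dBar ^ 2)) := by
        gcongr
        exact (dotProduct_mulVec_self_le_twoNorm _ θ).trans (by gcongr)
    _ = S.εq * S.αφ * ((S.sqrtPy *ᵥ yt) ⬝ᵥ (S.sqrtPy *ᵥ yt)) := by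
        have := hS.εq_pos.ne'
        rw [αφ]
        field_simp

/-- Young's inequality splits the mismatch of the regressors into the two margins `εq` and `αφ`
which the design keeps in reserve. -/
theorem Admissible.two_mul_regressor_mismatch_le (hS : S.Admissible) {e : Fin n → ℝ}
    {yt : Fin p → ℝ} {θ : Fin m → ℝ} {δ : ℝ} (hθ : ‖θ‖ ≤ S.dBar) (hδ : |δ| ≤ ‖e‖) :
    2 * (δ * (yt ⬝ᵥ (S.Py *ᵥ ((S.Cm * S.Bbar) *ᵥ θ)))) ≤
      S.εq * (e ⬝ᵥ e) + S.αφ * (yt ⬝ᵥ (S.Py *ᵥ yt)) := by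
  have hεq := hS.εq_pos
  have hδ_sq : δ ^ 2 ≤ e ⬝ᵥ e :=
    ((sq_le_sq₀ (abs_nonneg δ) (norm_nonneg e)).2 hδ |>.trans' (sq_abs δ).ge).trans
      (norm_sq_le_dotProduct_self e)
  calc _ ≤ S.εq * δ ^ 2 + S.εq⁻¹ * (yt ⬝ᵥ (S.Py *ᵥ ((S.Cm * S.Bbar) *ᵥ θ))) ^ 2 := by
        rw [← mul_assoc]
        exact two_mul_le_add_mul_sq hεq
    _ ≤ S.εq * (e ⬝ᵥ e) + S.εq⁻¹ * (S.εq * S.αφ * (yt ⬝ᵥ (S.Py *ᵥ yt))) := by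
        gcongr
        exact hS.dotProduct_Py_mulVec_sq_le yt hθ
    _ = _ := by field_simp

theorem Admissible.energy_rate_le (hS : S.Admissible) {e : Fin n → ℝ} {yt : Fin p → ℝ}
    {w θ : Fin m → ℝ} {δ : ℝ} (hθ : ‖θ‖ ≤ S.dBar) (hδ : |δ| ≤ ‖e‖) :
    2 * (e ⬝ᵥ (S.Pv *ᵥ (S.Av *ᵥ e - (S.Pv⁻¹ * S.Amᵀ * S.Cmᵀ * S.Py) *ᵥ yt))) +
      2 * (yt ⬝ᵥ (S.Py *ᵥ (-(S.α • yt) + (S.Cm * S.Am) *ᵥ e +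
        (S.Cm * S.Bbar) *ᵥ (w + δ • θ)))) ≤
      -S.lam₁ * (e ⬝ᵥ (S.Pv *ᵥ e) + yt ⬝ᵥ (S.Py *ᵥ yt)) +
        2 * (w ⬝ᵥ ((S.Bbarᵀ * S.Cmᵀ * S.Py) *ᵥ yt)) := by
  have hmismatch := hS.two_mul_regressor_mismatch_le (yt := yt) hθ hδ
  have hlyap := hS.two_mul_dotProduct_Pv_mulVec_Av e
  have he := hS.lam₁_mul_dotProduct_Pv_le e
  have hy := hS.lam₁_mul_dotProduct_Py_le yt
  simp only [mulVec_add, mulVec_sub, mulVec_neg, mulVec_smul, dotProduct_add, dotProduct_sub,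
    dotProduct_neg, dotProduct_smul, smul_eq_mul, hS.dotProduct_Pv_mulVec_coupling,
    ← hS.dotProduct_Py_mulVec_Cm_mul_Bbar]
  linarith

end Design

namespace Signals

variable {n m p nz mr nd : ℕ} {S : Design n m p nz} {W : Unknowns n m} {K : Controller m mr nd}
  {s : Signals n m p nz nd} {τ : ℝ} {xv : ℝ → Fin n → ℝ} {xf : ℝ → Fin nz → ℝ}

theorem IsVirtual.y_eq (hS : S.Admissible) (hW : W.Admissible S)
    (h : s.IsPlant S W τ) (hv : s.IsVirtual S W τ xv xf) {t : ℝ} (ht : t ∈ Icc 0 τ) :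
    s.y S t = S.Cm *ᵥ xv t := by
  rw [y, ← hv.state_eq hS hW h ht, Tg_mulVec_xg]
  simp only [mulVec_add, mulVec_smul, hS.Cm_mulVec_Tz, smul_zero, add_zero]

theorem IsVirtual.hasDerivWithinAt_y (hS : S.Admissible) (hW : W.Admissible S)
    (h : s.IsPlant S W τ) (hv : s.IsVirtual S W τ xv xf) {t : ℝ} (ht : t ∈ Icc 0 τ) :
    HasDerivWithinAt (s.y S) ((S.Cm * S.Am) *ᵥ xv t +
      (S.Cm * S.Bbar) *ᵥ (W.ω • s.uz S t + s.fBar S W xv xf t)) (Icc 0 τ) t := by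
  have hx := hv.state_eq hS hW h ht
  refine (hasDerivWithinAt_const_mulVec S.Cm (h.x_ode t ht)).congr_deriv ?_
  rw [fBar, fv, hx, uz, ← hS.output_field_eq, ← Tg_mulVec_xg, hx]

theorem IsVirtual.hasDerivWithinAt_xvHat_sub (hS : S.Admissible) (hW : W.Admissible S)
    (h : s.IsPlant S W τ) (he : s.IsEstimator S W K τ) (hv : s.IsVirtual S W τ xv xf) {t : ℝ}
    (ht : t ∈ Icc 0 τ) :
    HasDerivWithinAt (fun t => s.xvHat S t - xv t)
      (S.Av *ᵥ (s.xvHat S t - xv t) - (S.Pv⁻¹ * S.Amᵀ * S.Cmᵀ * S.Py) *ᵥ s.yTilde S t)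
      (Icc 0 τ) t := by
  refine (((he.vHat_ode t ht).fun_add (hasDerivWithinAt_const_mulVec S.H
    (hv.hasDerivWithinAt_y hS hW h ht))).fun_sub (hv.xv_ode t ht)).congr_deriv ?_
  have hinput : S.H *ᵥ ((S.Cm * S.Bbar) *ᵥ (W.ω • s.uz S t + s.fBar S W xv xf t)) =
      S.Bbar *ᵥ (W.ω • s.uz S t + s.fBar S W xv xf t) := by
    rw [mulVec_mulVec, hS.H_mul_Cm_mul_Bbar]
  have hAv : S.Av *ᵥ xv t = S.Am *ᵥ xv t - S.H *ᵥ ((S.Cm * S.Am) *ᵥ xv t) +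
      S.Kv *ᵥ (S.Cm *ᵥ xv t) := by
    rw [Design.Av, Design.AH, add_mulVec, Matrix.sub_mul, sub_mulVec, Matrix.one_mul,
      mulVec_mulVec, mulVec_mulVec, Matrix.mul_assoc]
  rw [mulVec_add, hinput, mulVec_sub S.Av, hAv, hv.y_eq hS hW h ht]
  abel

/-- The part of the input-estimation error `ηHat - (ω uz + fBar)` that is linear in the errors of
the adaptive estimates; what remains is the mismatch of the regressors `‖xgHat‖` and `‖xg‖`. -/
noncomputable def paramError (s : Signals n m p nz nd) (S : Design n m p nz) (W : Unknowns n m)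
    (θ σ : ℝ → Fin m → ℝ) (t : ℝ) : Fin m → ℝ :=
  (s.ωHat t - W.ω) • s.uz S t + ‖s.xgHat S t‖ • (s.θHat t - θ t) + (s.σHat t - σ t)

theorem IsVirtual.hasDerivWithinAt_yTilde (hS : S.Admissible) (hW : W.Admissible S)
    (h : s.IsPlant S W τ) (he : s.IsEstimator S W K τ) (hv : s.IsVirtual S W τ xv xf)
    {θ σ : ℝ → Fin m → ℝ} {t : ℝ} (ht : t ∈ Icc 0 τ)
    (hf : s.fBar S W xv xf t = ‖s.xg xv t‖ • θ t + σ t) :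
    HasDerivWithinAt (s.yTilde S)
      (-(S.α • s.yTilde S t) + (S.Cm * S.Am) *ᵥ (s.xvHat S t - xv t) +
        (S.Cm * S.Bbar) *ᵥ (s.paramError S W θ σ t +
          (‖s.xgHat S t‖ - ‖s.xg xv t‖) • θ t)) (Icc 0 τ) t := by
  refine ((he.yHat_ode t ht).fun_sub (hv.hasDerivWithinAt_y hS hW h ht)).congr_deriv ?_
  have hη : s.paramError S W θ σ t + (‖s.xgHat S t‖ - ‖s.xg xv t‖) • θ t =
      s.ηHat S t - (W.ω • s.uz S t + s.fBar S W xv xf t) := by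
    rw [hf, paramError, ηHat]
    module
  rw [hη, mulVec_sub, mulVec_sub]
  abel

theorem abs_norm_xgHat_sub_norm_xg_le (s : Signals n m p nz nd) (S : Design n m p nz)
    (xv : ℝ → Fin n → ℝ) (t : ℝ) :
    |‖s.xgHat S t‖ - ‖s.xg xv t‖| ≤ ‖s.xvHat S t - xv t‖ :=
  (abs_norm_sub_norm_le _ _).trans <| by
    simpa [xgHat, xg] using norm_sumElim_sub_sumElim_le (s.xvHat S t) (xv t) (s.xu t) (s.xu t)

end Signals

/-! ### Energy of the parameter errors -/

namespace Controller

variable {m mr nd : ℕ} {K : Controller m mr nd}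

theorem PosGains.Γ_pos (hK : K.PosGains) : 0 < K.Γ :=
  lt_min hK.Γω_pos (lt_min hK.Γθ_pos hK.Γσ_pos)

theorem Γ_le_Γω (K : Controller m mr nd) : K.Γ ≤ K.Γω := min_le_left _ _

theorem Γ_le_Γθ (K : Controller m mr nd) : K.Γ ≤ K.Γθ := (min_le_right _ _).trans (min_le_left _ _)

theorem Γ_le_Γσ (K : Controller m mr nd) : K.Γ ≤ K.Γσ := (min_le_right _ _).trans (min_le_right _ _)

end Controller

namespace Design

variable {n m p nz : ℕ} {S : Design n m p nz}

/-- With projection tolerance `ε` and smallest adaptation gain `Γ`, the Lyapunov function decreases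
wherever it exceeds `S.level ε lθ lσ / Γ`. The first summand bounds the parameter errors, the
second the effect of the motion of the true parameters. -/
noncomputable def level (S : Design n m p nz) (ε lθ lσ : ℝ) : ℝ :=
  (2 + ε) ^ 2 * (((S.ωu - S.ωl) / 2) ^ 2 + m * S.dBar ^ 2 + m * S.bBar ^ 2) +
    2 * (2 + ε) * (m * (S.dBar * lθ + S.bBar * lσ)) / S.lam₁

theorem Admissible.level_zero_lt (hS : S.Admissible) (lθ lσ : ℝ) :
    S.level 0 lθ lσ < S.θ₁ lθ lσ := by
  have hsq : ((S.ωu - S.ωl) / 2) ^ 2 < S.ωu ^ 2 :=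
    pow_lt_pow_left₀ (by linarith [hS.ωl_pos, hS.ωu_pos]) (by linarith [hS.ωl_lt]) two_ne_zero
  calc S.level 0 lθ lσ = 4 * (((S.ωu - S.ωl) / 2) ^ 2 + m * S.dBar ^ 2 + m * S.bBar ^ 2) +
        4 * m * ((S.dBar * lθ + S.bBar * lσ) / S.lam₁) := by rw [level]; ring
    _ < S.θ₁ lθ lσ := by rw [θ₁, θ₀]; gcongr

theorem Admissible.exists_forall_level_le (hS : S.Admissible) (lθ lσ : ℝ) :
    ∃ ε₀ > 0, ∀ ε, 0 < ε → ε ≤ ε₀ → S.level ε lθ lσ ≤ S.θ₁ lθ lσ := by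
  have hcont : Continuous fun ε => S.level ε lθ lσ := by unfold level; fun_prop
  obtain ⟨δ, hδ, hlt⟩ := Metric.eventually_nhds_iff.1
    (hcont.continuousAt.eventually_lt_const (hS.level_zero_lt lθ lσ))
  refine ⟨δ / 2, half_pos hδ, fun ε hε hεδ => (hlt ?_).le⟩
  rw [dist_zero_right, Real.norm_of_nonneg hε.le]
  linarith

theorem Admissible.θ₁_nonneg (hS : S.Admissible) {lθ lσ : ℝ} (hlθ : 0 ≤ lθ) (hlσ : 0 ≤ lσ) :
    0 ≤ S.θ₁ lθ lσ := by
  rw [θ₁, θ₀]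
  positivity [hS.dBar_nonneg, hS.bBar_nonneg, hS.lam₁_pos]

end Design

namespace Signals

section

variable {n m p nz nd : ℕ} {s : Signals n m p nz nd} {S : Design n m p nz} {W : Unknowns n m}
  {τ lθ lσ : ℝ}

/-- `xv`, `xf`, `θ`, `σ` are witnesses of `Parametrized`. -/
structure IsParametrization (s : Signals n m p nz nd) (S : Design n m p nz) (W : Unknowns n m)
    (τ lθ lσ : ℝ) (xv : ℝ → Fin n → ℝ) (xf : ℝ → Fin nz → ℝ) (θ σ : ℝ → Fin m → ℝ) : Prop where
  isVirtual : s.IsVirtual S W τ xv xf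
  fBar_eq : ∀ t ∈ Icc 0 τ, s.fBar S W xv xf t = ‖s.xg xv t‖ • θ t + σ t
  norm_θ_le : ∀ t ∈ Icc 0 τ, ‖θ t‖ ≤ S.dBar
  norm_σ_le : ∀ t ∈ Icc 0 τ, ‖σ t‖ ≤ S.bBar
  norm_θ_sub_le : ∀ t ∈ Icc 0 τ, ∀ t' ∈ Icc 0 τ, ‖θ t - θ t'‖ ≤ lθ * |t - t'|
  norm_σ_sub_le : ∀ t ∈ Icc 0 τ, ∀ t' ∈ Icc 0 τ, ‖σ t - σ t'‖ ≤ lσ * |t - t'|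

theorem Parametrized.exists_isParametrization (h : s.Parametrized S W τ lθ lσ) :
    ∃ xv xf θ σ, s.IsParametrization S W τ lθ lσ xv xf θ σ := by
  obtain ⟨xv, xf, θ, σ, hv, hf, hbd, hlip⟩ := h
  exact ⟨xv, xf, θ, σ, hv, hf, fun t ht => (hbd t ht).1, fun t ht => (hbd t ht).2,
    fun t ht t' ht' => (hlip t ht t' ht').1, fun t ht t' ht' => (hlip t ht t' ht').2⟩

end

variable {n m p nz mr nd : ℕ} {S : Design n m p nz} {W : Unknowns n m} {K : Controller m mr nd}
  {s : Signals n m p nz nd} {τ lθ lσ : ℝ} {xv : ℝ → Fin n → ℝ} {xf : ℝ → Fin nz → ℝ}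
  {θ σ : ℝ → Fin m → ℝ}

/-- The squared errors of the adaptive estimates, weighted by the inverse adaptation gains. -/
noncomputable def parameterEnergy (s : Signals n m p nz nd) (W : Unknowns n m)
    (K : Controller m mr nd) (θ σ : ℝ → Fin m → ℝ) (t : ℝ) : ℝ :=
  (s.ωHat t - W.ω) ^ 2 / K.Γω + (s.θHat t - θ t) ⬝ᵥ (s.θHat t - θ t) / K.Γθ +
    (s.σHat t - σ t) ⬝ᵥ (s.σHat t - σ t) / K.Γσ

theorem parameterEnergy_nonneg (hK : K.PosGains) (t : ℝ) : 0 ≤ s.parameterEnergy W K θ σ t :=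
  add_nonneg (add_nonneg (div_nonneg (sq_nonneg _) hK.Γω_pos.le)
    (div_nonneg (dotProduct_self_nonneg _) hK.Γθ_pos.le))
    (div_nonneg (dotProduct_self_nonneg _) hK.Γσ_pos.le)

theorem norm_sub_midpoint_le {a b ω : ℝ} (hω : ω ∈ Icc a b) :
    ‖ω - (a + b) / 2‖ ≤ (b - a) / 2 := by
  rw [Real.norm_eq_abs, abs_le]
  constructor <;> linarith [hω.1, hω.2]

theorem IsEstimator.ωHat_sub_sq_le (hS : S.Admissible) (hW : W.Admissible S) (hK : K.PosGains)
    (he : s.IsEstimator S W K τ) {t : ℝ} (ht : t ∈ Icc 0 τ) :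
    (s.ωHat t - W.ω) ^ 2 ≤ (2 + K.ε) ^ 2 * ((S.ωu - S.ωl) / 2) ^ 2 := by
  have hr : 0 < (S.ωu - S.ωl) / 2 := half_pos (sub_pos.2 hS.ωl_lt)
  rw [← sq_abs, ← Real.norm_eq_abs, ← mul_pow]
  gcongr
  exact norm_sub_le_of_smoothProj_ode hK.ε_pos hr hK.Γω_pos
    (by rw [he.ωHat_zero]; exact norm_sub_midpoint_le hS.one_mem) he.ωHat_ode
    (norm_sub_midpoint_le hW.ω_mem) ht

theorem IsEstimator.rightDiniLE_ωHat (hS : S.Admissible) (hW : W.Admissible S) (hK : K.PosGains)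
    (he : s.IsEstimator S W K τ) {x : ℝ} (hx : x ∈ Ico 0 τ) :
    RightDiniLE (fun t => (s.ωHat t - W.ω) ^ 2 / K.Γω)
      (-(2 * ((s.ωHat x - W.ω) * (s.uz S x ⬝ᵥ s.ey S x)))) x := by
  have h := rightDiniLE_of_smoothProj_ode (L := 0) hK.ε_pos (half_pos (sub_pos.2 hS.ωl_lt))
    hK.Γω_pos (by rw [he.ωHat_zero]; exact norm_sub_midpoint_le hS.one_mem) he.ωHat_ode
    (fun _ _ => norm_sub_midpoint_le hW.ω_mem) (fun _ _ _ _ => by simp) hx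
  simp only [Real.norm_eq_abs, sq_abs] at h
  refine h.mono (le_of_eq ?_)
  rw [real_inner_eq_re_inner, RCLike.inner_apply]
  simp only [conj_trivial, RCLike.re_to_real]
  ring

theorem IsParametrization.parameterEnergy_le (hS : S.Admissible) (hW : W.Admissible S)
    (hK : K.PosGains) (he : s.IsEstimator S W K τ) (hp : s.IsParametrization S W τ lθ lσ xv xf θ σ)
    {t : ℝ} (ht : t ∈ Icc 0 τ) :
    s.parameterEnergy W K θ σ t ≤
      (2 + K.ε) ^ 2 * (((S.ωu - S.ωl) / 2) ^ 2 + m * S.dBar ^ 2 + m * S.bBar ^ 2) / K.Γ := by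
  have hΓ := hK.Γ_pos
  have hω := div_le_div₀ (by positivity) (he.ωHat_sub_sq_le hS hW hK ht) hΓ K.Γ_le_Γω
  have hθ := div_le_div₀ (by positivity) (dotProduct_sub_self_le_of_vecProj_ode hK.ε_pos
    hS.dBar_pos hK.Γθ_pos he.θHat_zero he.θHat_ode (hp.norm_θ_le t ht) ht) hΓ K.Γ_le_Γθ
  have hσ := div_le_div₀ (by positivity) (dotProduct_sub_self_le_of_vecProj_ode hK.ε_pos
    hS.bBar_pos hK.Γσ_pos he.σHat_zero he.σHat_ode (hp.norm_σ_le t ht) ht) hΓ K.Γ_le_Γσ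
  rw [parameterEnergy, mul_add, mul_add, add_div, add_div]
  exact add_le_add (add_le_add hω hθ) hσ

/-- The adaptive laws are chosen so that the first summand cancels the contribution of the
parameter errors to the growth of `errorEnergy`. -/
theorem IsParametrization.rightDiniLE_parameterEnergy (hS : S.Admissible) (hW : W.Admissible S)
    (hK : K.PosGains) (he : s.IsEstimator S W K τ) (hlθ : 0 ≤ lθ) (hlσ : 0 ≤ lσ)
    (hp : s.IsParametrization S W τ lθ lσ xv xf θ σ) {x : ℝ} (hx : x ∈ Ico 0 τ) :
    RightDiniLE (s.parameterEnergy W K θ σ)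
      (-(2 * (s.paramError S W θ σ x ⬝ᵥ s.ey S x)) +
        2 * (2 + K.ε) * (m * (S.dBar * lθ + S.bBar * lσ)) / K.Γ) x := by
  have hΓ := hK.Γ_pos
  have hε := hK.ε_pos
  have hd := hS.dBar_nonneg
  have hb := hS.bBar_nonneg
  have hθ := rightDiniLE_of_vecProj_ode hε hS.dBar_pos hK.Γθ_pos he.θHat_zero he.θHat_ode
    hp.norm_θ_le hp.norm_θ_sub_le hx
  have hσ := rightDiniLE_of_vecProj_ode hε hS.bBar_pos hK.Γσ_pos he.σHat_zero he.σHat_ode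
    hp.norm_σ_le hp.norm_σ_sub_le hx
  refine (((he.rightDiniLE_ωHat hS hW hK hx).add hθ).add hσ).mono ?_
  have hθΓ : 2 * (2 + K.ε) * (m * (S.dBar * lθ)) / K.Γθ ≤
      2 * (2 + K.ε) * (m * (S.dBar * lθ)) / K.Γ :=
    div_le_div_of_nonneg_left (by positivity) hΓ K.Γ_le_Γθ
  have hσΓ : 2 * (2 + K.ε) * (m * (S.bBar * lσ)) / K.Γσ ≤
      2 * (2 + K.ε) * (m * (S.bBar * lσ)) / K.Γ :=
    div_le_div_of_nonneg_left (by positivity) hΓ K.Γ_le_Γσ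
  simp only [paramError, add_dotProduct, smul_dotProduct, dotProduct_neg, dotProduct_smul,
    smul_eq_mul, mul_add, add_div] at hθΓ hσΓ ⊢
  linarith

theorem IsParametrization.continuousOn_parameterEnergy (he : s.IsEstimator S W K τ)
    (hp : s.IsParametrization S W τ lθ lσ xv xf θ σ) :
    ContinuousOn (s.parameterEnergy W K θ σ) (Icc 0 τ) := by
  have hω : ContinuousOn s.ωHat (Icc 0 τ) := fun t ht => (he.ωHat_ode t ht).continuousWithinAt
  have hθHat : ContinuousOn s.θHat (Icc 0 τ) := fun t ht => (he.θHat_ode t ht).continuousWithinAt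
  have hσHat : ContinuousOn s.σHat (Icc 0 τ) := fun t ht => (he.σHat_ode t ht).continuousWithinAt
  have hθ : ContinuousOn θ (Icc 0 τ) := (LipschitzOnWith.of_dist_le' (K := lθ) fun t ht t' ht' =>
    by simpa only [dist_eq_norm, Real.norm_eq_abs] using
      hp.norm_θ_sub_le t ht t' ht').continuousOn
  have hσ : ContinuousOn σ (Icc 0 τ) := (LipschitzOnWith.of_dist_le' (K := lσ) fun t ht t' ht' =>
    by simpa only [dist_eq_norm, Real.norm_eq_abs] using
      hp.norm_σ_sub_le t ht t' ht').continuousOn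
  unfold parameterEnergy dotProduct
  fun_prop

/-! ### The Lyapunov argument -/

/-- The energy of the prediction errors `xvHat - xv` and `yTilde` relative to a solution of the
virtual system. -/
noncomputable def errorEnergy (s : Signals n m p nz nd) (S : Design n m p nz) (xv : ℝ → Fin n → ℝ)
    (t : ℝ) : ℝ :=
  (s.xvHat S t - xv t) ⬝ᵥ (S.Pv *ᵥ (s.xvHat S t - xv t)) +
    s.yTilde S t ⬝ᵥ (S.Py *ᵥ s.yTilde S t)

theorem IsParametrization.exists_hasDerivWithinAt_errorEnergy (hS : S.Admissible)
    (hW : W.Admissible S) (h : s.IsPlant S W τ) (he : s.IsEstimator S W K τ)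
    (hp : s.IsParametrization S W τ lθ lσ xv xf θ σ) {t : ℝ} (ht : t ∈ Icc 0 τ) :
    ∃ E' ≤ -S.lam₁ * s.errorEnergy S xv t + 2 * (s.paramError S W θ σ t ⬝ᵥ s.ey S t),
      HasDerivWithinAt (s.errorEnergy S xv) E' (Icc 0 τ) t :=
  ⟨_, hS.energy_rate_le (hp.norm_θ_le t ht) (s.abs_norm_xgHat_sub_norm_xg_le S xv t),
    (hasDerivWithinAt_quadraticForm hS.transpose_Pv
      (hp.isVirtual.hasDerivWithinAt_xvHat_sub hS hW h he ht)).fun_add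
    (hasDerivWithinAt_quadraticForm hS.transpose_Py
      (hp.isVirtual.hasDerivWithinAt_yTilde hS hW h he ht (hp.fBar_eq t ht)))⟩

theorem IsParametrization.rightDiniLE_energy (hS : S.Admissible) (hW : W.Admissible S)
    (hK : K.PosGains) (h : s.IsPlant S W τ) (he : s.IsEstimator S W K τ) (hlθ : 0 ≤ lθ)
    (hlσ : 0 ≤ lσ) (hp : s.IsParametrization S W τ lθ lσ xv xf θ σ) {x : ℝ} (hx : x ∈ Ico 0 τ) :
    RightDiniLE (fun t => s.errorEnergy S xv t + s.parameterEnergy W K θ σ t)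
      (-S.lam₁ * (s.errorEnergy S xv x + s.parameterEnergy W K θ σ x -
        S.level K.ε lθ lσ / K.Γ)) x := by
  have hx' := Ico_subset_Icc_self hx
  have hlam := hS.lam₁_pos
  obtain ⟨E', hE', hd⟩ := hp.exists_hasDerivWithinAt_errorEnergy hS hW h he hx'
  refine ((rightDiniLE_of_hasDerivWithinAt (hasDerivWithinAt_Ici_of_Icc hx hd)).add
    (hp.rightDiniLE_parameterEnergy hS hW hK he hlθ hlσ hx)).mono ?_
  have hΦ := mul_le_mul_of_nonneg_left (hp.parameterEnergy_le hS hW hK he hx') hlam.le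
  have hlevel : S.lam₁ * (S.level K.ε lθ lσ / K.Γ) =
      S.lam₁ * ((2 + K.ε) ^ 2 *
        (((S.ωu - S.ωl) / 2) ^ 2 + m * S.dBar ^ 2 + m * S.bBar ^ 2) / K.Γ) +
      2 * (2 + K.ε) * (m * (S.dBar * lθ + S.bBar * lσ)) / K.Γ := by
    rw [Design.level]
    field_simp
  linarith

theorem IsParametrization.errorEnergy_le (hS : S.Admissible) (hW : W.Admissible S)
    (hK : K.PosGains) (h : s.IsPlant S W τ) (he : s.IsEstimator S W K τ) (hlθ : 0 ≤ lθ)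
    (hlσ : 0 ≤ lσ) (hp : s.IsParametrization S W τ lθ lσ xv xf θ σ) {t : ℝ} (ht : t ∈ Icc 0 τ) :
    s.errorEnergy S xv t ≤
      S.level K.ε lθ lσ / K.Γ + s.errorEnergy S xv 0 * Real.exp (-S.lam₁ * t) := by
  have hE : ContinuousOn (s.errorEnergy S xv) (Icc 0 τ) := fun r hr =>
    let ⟨_, _, hd⟩ := hp.exists_hasDerivWithinAt_errorEnergy hS hW h he hr
    hd.continuousWithinAt
  have hgronwall := RightDiniLE.le_add_mul_exp (hE.add (hp.continuousOn_parameterEnergy he))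
    (fun x hx => hp.rightDiniLE_energy hS hW hK h he hlθ hlσ hx) ht
  have hΦ0 : s.parameterEnergy W K θ σ 0 ≤ S.level K.ε lθ lσ / K.Γ := by
    refine (hp.parameterEnergy_le hS hW hK he ⟨le_rfl, ht.1.trans ht.2⟩).trans
      (div_le_div_of_nonneg_right (le_add_of_nonneg_right ?_) hK.Γ_pos.le)
    positivity [hK.ε_pos, hS.dBar_nonneg, hS.bBar_nonneg, hS.lam₁_pos]
  calc s.errorEnergy S xv t ≤ s.errorEnergy S xv t + s.parameterEnergy W K θ σ t :=
        le_add_of_nonneg_right (parameterEnergy_nonneg hK t)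
    _ ≤ _ := hgronwall
    _ ≤ _ := by
        rw [Pi.add_apply]
        gcongr
        linarith

theorem IsVirtual.errorEnergy_zero (h : s.IsPlant S W τ) (he : s.IsEstimator S W K τ)
    (hv : s.IsVirtual S W τ xv xf) :
    s.errorEnergy S xv 0 = W.x₀ ⬝ᵥ (S.PvBar *ᵥ W.x₀) := by
  have hy : s.yTilde S 0 = 0 := by rw [yTilde, y, he.yHat_zero, h.x_zero, sub_self]
  have hxv : s.xvHat S 0 - xv 0 = -((1 - S.H * S.Cm) *ᵥ W.x₀) := by
    rw [xvHat, y, he.vHat_zero, h.x_zero, hv.xv_zero, sub_mulVec, one_mulVec, mulVec_mulVec]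
    abel
  rw [errorEnergy, hy, zero_dotProduct, add_zero, hxv, mulVec_neg, neg_dotProduct_neg,
    Design.PvBar, Matrix.mul_assoc, ← mulVec_mulVec, dotProduct_transpose_mulVec,
    dotProduct_comm, ← mulVec_mulVec]

theorem IsVirtual.errorEnergy_zero_le (hS : S.Admissible) (h : s.IsPlant S W τ)
    (he : s.IsEstimator S W K τ) (hv : s.IsVirtual S W τ xv xf) :
    s.errorEnergy S xv 0 ≤ n * lambdaMax S.PvBar * ‖W.x₀‖ ^ 2 := by
  have hmax := lambdaMax_nonneg hS.posSemidef_PvBar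
  calc s.errorEnergy S xv 0 = W.x₀ ⬝ᵥ (S.PvBar *ᵥ W.x₀) := hv.errorEnergy_zero h he
    _ ≤ lambdaMax S.PvBar * (W.x₀ ⬝ᵥ W.x₀) :=
        dotProduct_le_lambdaMax_mul hS.posSemidef_PvBar.isHermitian W.x₀
    _ ≤ lambdaMax S.PvBar * (n * ‖W.x₀‖ ^ 2) := by
        gcongr
        simpa only [Fintype.card_fin] using dotProduct_self_le_card_mul_norm_sq W.x₀
    _ = n * lambdaMax S.PvBar * ‖W.x₀‖ ^ 2 := by ring

theorem lambdaMin_Py_mul_norm_yTilde_sq_le (hS : S.Admissible) (hp : 0 < p) (t : ℝ) :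
    lambdaMin S.Py * ‖s.yTilde S t‖ ^ 2 ≤ s.errorEnergy S xv t :=
  calc lambdaMin S.Py * ‖s.yTilde S t‖ ^ 2 ≤ lambdaMin S.Py * (s.yTilde S t ⬝ᵥ s.yTilde S t) :=
        mul_le_mul_of_nonneg_left (norm_sq_le_dotProduct_self _) (lambdaMin_pos hp hS.Py_pos).le
    _ ≤ s.yTilde S t ⬝ᵥ (S.Py *ᵥ s.yTilde S t) :=
        lambdaMin_mul_dotProduct_le hS.Py_pos.isHermitian _
    _ ≤ s.errorEnergy S xv t :=
        le_add_of_nonneg_left (dotProduct_mulVec_self_nonneg hS.Pv_pos.posSemidef _)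

theorem norm_yTilde_le_of_errorEnergy_le (hS : S.Admissible) {c Γ E₀ : ℝ} (hc : 0 ≤ c)
    (hΓ : 0 < Γ) {t : ℝ} {x₀ : Fin n → ℝ} (hE₀ : E₀ ≤ n * lambdaMax S.PvBar * ‖x₀‖ ^ 2)
    (hE : s.errorEnergy S xv t ≤ c / Γ + E₀ * Real.exp (-S.lam₁ * t)) :
    ‖s.yTilde S t‖ ≤ S.κy * Real.exp (-(S.lam₁ / 2) * t) * ‖x₀‖ +
      √(c / lambdaMin S.Py) * (1 / √Γ) := by
  have hκ : 0 ≤ S.κy := Real.sqrt_nonneg _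
  rcases p.eq_zero_or_pos with rfl | hp
  · rw [Subsingleton.elim (s.yTilde S t) 0, norm_zero]
    positivity
  have hmin := lambdaMin_pos hp hS.Py_pos
  have hmax := lambdaMax_nonneg hS.posSemidef_PvBar
  set a := S.κy * Real.exp (-(S.lam₁ / 2) * t) * ‖x₀‖ with ha
  set b := √(c / lambdaMin S.Py) * (1 / √Γ) with hb
  have ha_sq : lambdaMin S.Py * a ^ 2 =
      n * lambdaMax S.PvBar * ‖x₀‖ ^ 2 * Real.exp (-S.lam₁ * t) := by
    have hexp : Real.exp (-(S.lam₁ / 2) * t) ^ 2 = Real.exp (-S.lam₁ * t) := by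
      rw [← Real.exp_nat_mul]
      congr 1
      push_cast
      ring
    rw [ha, mul_pow, mul_pow, hexp, Design.κy, Real.sq_sqrt (by positivity)]
    field_simp
  have hb_sq : lambdaMin S.Py * b ^ 2 = c / Γ := by
    rw [hb, mul_pow, div_pow, Real.sq_sqrt (by positivity), Real.sq_sqrt hΓ.le]
    field_simp
  have hsq : ‖s.yTilde S t‖ ^ 2 ≤ a ^ 2 + b ^ 2 := by
    refine le_of_mul_le_mul_left ?_ hmin
    calc _ ≤ s.errorEnergy S xv t := lambdaMin_Py_mul_norm_yTilde_sq_le hS hp t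
      _ ≤ c / Γ + n * lambdaMax S.PvBar * ‖x₀‖ ^ 2 * Real.exp (-S.lam₁ * t) := by
          refine hE.trans ?_
          gcongr
      _ = _ := by rw [mul_add, ha_sq, hb_sq, add_comm]
  refine le_of_sq_le_sq (hsq.trans ?_) (by positivity)
  nlinarith [show 0 ≤ a * b by positivity]

theorem Parametrized.norm_yTilde_le (hS : S.Admissible) (hW : W.Admissible S) (hK : K.PosGains)
    (h : s.IsPlant S W τ) (he : s.IsEstimator S W K τ) (hlθ : 0 ≤ lθ) (hlσ : 0 ≤ lσ)
    (hlevel : S.level K.ε lθ lσ ≤ S.θ₁ lθ lσ) (hp : s.Parametrized S W τ lθ lσ) {t : ℝ}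
    (ht : t ∈ Icc 0 τ) :
    ‖s.yTilde S t‖ ≤ S.κy * Real.exp (-(S.lam₁ / 2) * t) * ‖W.x₀‖ +
      √(S.θ₁ lθ lσ / lambdaMin S.Py) * (1 / √K.Γ) := by
  obtain ⟨xv, xf, θ, σ, hp⟩ := hp.exists_isParametrization
  refine norm_yTilde_le_of_errorEnergy_le hS (hS.θ₁_nonneg hlθ hlσ) hK.Γ_pos
    (hp.isVirtual.errorEnergy_zero_le hS h he)
    ((hp.errorEnergy_le hS hW hK h he hlθ hlσ ht).trans ?_)
  gcongr
  exact hK.Γ_pos.le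

end Signals

end L1Adaptive

theorem lemma5_general {n m p nz : ℕ} (S : L1Adaptive.Design n m p nz) (hS : S.Admissible) :
    (∃ lθ ≥ 0, ∃ lσ ≥ 0, ∀ (nd : ℕ) (W : L1Adaptive.Unknowns n m)
        (s : L1Adaptive.Signals n m p nz nd) (τ : ℝ),
      W.Admissible S → 0 ≤ τ → s.IsPlant S W τ → ContinuousOn s.u (Icc 0 τ) → s.Bounded S τ →
      s.Parametrized S W τ lθ lσ) ∧
    (∀ lθ ≥ 0, ∀ lσ ≥ 0, ∃ ε₀ > 0,
      ∀ (mr nd : ℕ) (W : L1Adaptive.Unknowns n m) (K : L1Adaptive.Controller m mr nd)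
        (s : L1Adaptive.Signals n m p nz nd) (τ : ℝ),
        W.Admissible S → K.PosGains → K.ε ≤ ε₀ → s.IsPlant S W τ → s.IsEstimator S W K τ →
        s.Parametrized S W τ lθ lσ → ∀ t ∈ Icc 0 τ,
          ‖s.yTilde S t‖ ≤ S.κy * Real.exp (-(S.lam₁ / 2) * t) * ‖W.x₀‖ +
            √(S.θ₁ lθ lσ / L1Adaptive.lambdaMin S.Py) * (1 / √K.Γ)) := by
  constructor
  · exact ⟨_, mul_nonneg hS.dBar_nonneg hS.paramRate_nonneg,
      _, mul_nonneg hS.bBar_nonneg hS.paramRate_nonneg,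
      fun nd W s τ hW hτ h hu hb => h.parametrized hS hW hτ hu hb⟩
  · intro lθ hlθ lσ hlσ
    obtain ⟨ε₀, hε₀, hlevel⟩ := hS.exists_forall_level_le lθ lσ
    exact ⟨ε₀, hε₀, fun mr nd W K s τ hW hK hε h he hp t ht =>
      hp.norm_yTilde_le hS hW hK h he hlθ hlσ (hlevel K.ε hK.ε_pos hε) ht⟩

/-- First part: rate bounds `lθ`, `lσ` for the parametrization of the lumped uncertainty exist and
depend on the design data only. Second part: with any such rate bounds, the output-estimation
error obeys the claimed bound, provided the tolerance of the projection operators is small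
enough; how small does not depend on the unknowns, the adaptation gains, the rest of the
controller or `τ`. -/
theorem lemma5 {n m p nz : ℕ} (S : L1Adaptive.Design n m p nz) (hS : S.Admissible) :
    (∃ lθ ≥ 0, ∃ lσ ≥ 0,
      ∀ (mr nd : ℕ) (W : L1Adaptive.Unknowns n m) (K : L1Adaptive.Controller m mr nd)
        (s : L1Adaptive.Signals n m p nz nd) (τ : ℝ),
        W.Admissible S → K.Admissible S → 0 < τ → s.IsClosedLoop S W K τ → s.Bounded S τ →
        s.Parametrized S W τ lθ lσ) ∧
    (∀ lθ ≥ 0, ∀ lσ ≥ 0, ∃ ε₀ > 0,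
      ∀ (mr nd : ℕ) (W : L1Adaptive.Unknowns n m) (K : L1Adaptive.Controller m mr nd)
        (s : L1Adaptive.Signals n m p nz nd) (τ : ℝ),
        W.Admissible S → K.Admissible S → K.ε ≤ ε₀ → 0 < τ → s.IsClosedLoop S W K τ →
        s.Bounded S τ → s.Parametrized S W τ lθ lσ →
        ∀ t ∈ Set.Icc 0 τ,
          ‖s.yTilde S t‖ ≤ S.κy * Real.exp (-(S.lam₁ / 2) * t) * ‖W.x₀‖ +
            √(S.θ₁ lθ lσ / L1Adaptive.lambdaMin S.Py) * (1 / √K.Γ)) := by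
  obtain ⟨⟨lθ, hlθ, lσ, hlσ, hrate⟩, herror⟩ := lemma5_general S hS
  refine ⟨⟨lθ, hlθ, lσ, hlσ, fun _ nd W _ s τ hW _ hτ h hb =>
    hrate nd W s τ hW hτ.le h.isPlant h.continuousOn_u hb⟩, fun lθ hlθ lσ hlσ => ?_⟩
  obtain ⟨ε₀, hε₀, hbound⟩ := herror lθ hlθ lσ hlσ
  exact ⟨ε₀, hε₀, fun mr nd W K s τ hW hK hε _ h _ hp =>
    hbound mr nd W K s τ hW hK.posGains hε h.isPlant h.isEstimator hp⟩
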